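/- Consider the Erlang-A ($M/M/n+M$) system with $n$ servers, arrival rate $\lambda$, service rate $\mu$ and abandonment rate $\alpha>0$: the number of customers $X$ is the continuous-time birth-death chain on $\{0,1,2,\dots\}$ with birth rate $\lambda$ and death rate $(k\wedge n)\mu+(k-n)^+\alpha$ in state $k$. Let $R=\lambda/\mu$, let $x(\infty)$ be the unique solution of $\lambda=(x(\infty)\wedge n)\mu+(x(\infty)-n)^+\alpha$ (that is, $x(\infty)=n+(\lambda-n\mu)/\alpha$ if $R\ge n$ and $x(\infty)=R$ if $R<n$), and put $\tilde X(\infty)=(X(\infty)-x(\infty))/\sqrt R$, where $X(\infty)$ has the stationary distribution of $X$. Let $\zeta=(x(\infty)-n)/\sqrt R$, let $$b(x)=\big[(x+\zeta)^--\zeta^-\big]\mu-\big[(x+\zeta)^+-\zeta^+\big]\alpha,$$ where $a^+=\max(a,0)$ and $a^-=\max(-a,0)$, and let $Y(\infty)$ have the density $\kappa\exp\big(\frac1\mu\int_0^x b(y)\,dy\big)$ on $\mathbb R$, where $\kappa>0$ is the normalizing constant. There exists an increasing function $C_W:\mathbb R_+\to\mathbb R_+$ such that for all integers $n\ge1$ and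 all $\lambda,\mu,\alpha>0$ with $R\ge1$, both $\tilde X(\infty)$ and $Y(\infty)$ have finite mean and $$d_W(\tilde X(\infty),Y(\infty))=\sup_{h}\big|\mathbb E h(\tilde X(\infty))-\mathbb E h(Y(\infty))\big|\le\frac{C_W(\alpha/\mu)}{\sqrt R},$$ where the supremum is over all $h:\mathbb R\to\mathbb R$ with $|h(x)-h(y)|\le|x-y|$ for all $x,y$. -/

import Mathlib

open MeasureTheory
open scoped ENNReal

noncomputable section

/-- The offered load `R = lam / mu`. -/
def offeredLoad (lam mu : ℝ) : ℝ := lam / mu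

/-- Total departure rate (service completions plus abandonments) of the Erlang-A system when
`x` customers are present: `(x ∧ n) mu + (x - n)⁺ alpha`. -/
def departureRate (n : ℕ) (mu alpha : ℝ) (x : ℝ) : ℝ :=
  min x n * mu + max (x - n) 0 * alpha

/-- Truncated transition probabilities of the birth-death chain on `ℕ` with birth rates `b` and
death rates `d`: the probability of going from `i` to `j` in time `t` with fewer than `m` jumps.
The recursion conditions on the time `s` and the target of the first jump; the holding time in
state `i` is exponential with rate `b i + d i`. Used with `d 0 = 0`. -/
def birthDeathIter (b d : ℕ → ℝ) : ℕ → ℝ → ℕ → ℕ → ℝ≥0∞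
  | 0, _, _, _ => 0
  | m + 1, t, i, j =>
    (if i = j then ENNReal.ofReal (Real.exp (-(b i + d i) * t)) else 0) +
      ∫⁻ s in Set.Icc 0 t, ENNReal.ofReal (Real.exp (-(b i + d i) * s)) *
        (ENNReal.ofReal (b i) * birthDeathIter b d m (t - s) (i + 1) j +
          ENNReal.ofReal (d i) * birthDeathIter b d m (t - s) (i - 1) j)

/-- Transition function `P(t)(i, j)` of the continuous-time birth-death chain with birth rates `b`
and death rates `d` (finitely many jumps in `[0, t]`): the increasing limit of the truncated
probabilities, i.e. the minimal nonnegative solution of the backward equation. -/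
def birthDeathTransition (b d : ℕ → ℝ) (t : ℝ) (i j : ℕ) : ℝ≥0∞ :=
  ⨆ m, birthDeathIter b d m t i j

/-- Transition function of the customer-count process `X` of the Erlang-A system. -/
def erlangATransition (n : ℕ) (lam mu alpha : ℝ) (t : ℝ) (i j : ℕ) : ℝ≥0∞ :=
  birthDeathTransition (fun _ => lam) (fun k => departureRate n mu alpha k) t i j

/-- `p` is a stationary distribution of the customer-count process `X` of the Erlang-A system:
a probability measure on `ℕ` with `p P(t) = p` for all `t ≥ 0`. -/
def IsErlangAStationary (n : ℕ) (lam mu alpha : ℝ) (p : Measure ℕ) : Prop :=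
  IsProbabilityMeasure p ∧
    ∀ t : ℝ, 0 ≤ t → ∀ j : ℕ,
      ∑' i : ℕ, p {i} * erlangATransition n lam mu alpha t i j = p {j}

/-- The fluid equilibrium `x(∞)`. -/
def fluidEquilibrium (n : ℕ) (lam mu alpha : ℝ) : ℝ :=
  if (n : ℝ) ≤ offeredLoad lam mu then n + (lam - n * mu) / alpha else offeredLoad lam mu

/-- `x(∞)` is the unique solution of the flow balance equation. -/
theorem flowBalance_iff (n : ℕ) (lam mu alpha : ℝ) (hmu : 0 < mu) (halpha : 0 < alpha) (x : ℝ) :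
    lam = departureRate n mu alpha x ↔ x = fluidEquilibrium n lam mu alpha := by
  unfold departureRate fluidEquilibrium offeredLoad
  have hR : lam = lam / mu * mu := by field_simp
  split_ifs with h
  · rw [le_div_iff₀ hmu] at h
    constructor
    · intro hx
      rcases lt_or_ge x n with h1 | h1
      · rw [min_eq_left h1.le, max_eq_right (by linarith)] at hx
        nlinarith
      · rw [min_eq_right h1, max_eq_left (by linarith)] at hx
        field_simp
        linarith
    · rintro rfl
      have h2 : 0 ≤ (lam - n * mu) / alpha := div_nonneg (by linarith) halpha.le
      rw [min_eq_right (by linarith), max_eq_left (by linarith)]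
      field_simp
      ring
  · push Not at h
    constructor
    · intro hx
      rcases lt_or_ge x n with h1 | h1
      · rw [min_eq_left h1.le, max_eq_right (by linarith)] at hx
        field_simp
        linarith
      · rw [min_eq_right h1, max_eq_left (by linarith)] at hx
        rw [div_lt_iff₀ hmu] at h
        nlinarith [mul_nonneg (sub_nonneg.2 h1) halpha.le]
    · rintro rfl
      rw [min_eq_left h.le, max_eq_right (by linarith)]
      linarith

/-- Law of the scaled variable `(X(∞) - x(∞)) / √R` when `X(∞)` has law `p`. -/
def scaledLaw (n : ℕ) (lam mu alpha : ℝ) (p : Measure ℕ) : Measure ℝ :=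
  p.map fun k : ℕ =>
    ((k : ℝ) - fluidEquilibrium n lam mu alpha) / Real.sqrt (offeredLoad lam mu)

/-- `ζ = (x(∞) - n) / √R`. -/
def zetaParam (n : ℕ) (lam mu alpha : ℝ) : ℝ :=
  (fluidEquilibrium n lam mu alpha - n) / Real.sqrt (offeredLoad lam mu)

/-- The drift `b(x) = [(x + ζ)⁻ - ζ⁻] mu - [(x + ζ)⁺ - ζ⁺] alpha`. -/
def diffusionDrift (n : ℕ) (lam mu alpha : ℝ) (x : ℝ) : ℝ :=
  (max (-(x + zetaParam n lam mu alpha)) 0 - max (-zetaParam n lam mu alpha) 0) * mu -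
    (max (x + zetaParam n lam mu alpha) 0 - max (zetaParam n lam mu alpha) 0) * alpha

/-- The unnormalized density `exp ((1 / mu) ∫₀ˣ b(y) dy)`. -/
def diffusionWeight (n : ℕ) (lam mu alpha : ℝ) (x : ℝ) : ℝ :=
  Real.exp (1 / mu * ∫ y in (0 : ℝ)..x, diffusionDrift n lam mu alpha y)

/-- The law of `Y(∞)`: density `κ exp ((1 / mu) ∫₀ˣ b(y) dy)`, with `κ` the normalizing
constant. -/
def diffusionLaw (n : ℕ) (lam mu alpha : ℝ) : Measure ℝ :=
  volume.withDensity fun x =>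
    ENNReal.ofReal ((∫ y, diffusionWeight n lam mu alpha y)⁻¹ * diffusionWeight n lam mu alpha x)

/-- Wasserstein distance of two laws on `ℝ` (with finite first moments):
`sup |E h(U) - E h(V)|` over all functions `h` with Lipschitz constant `1`. -/
def wassersteinDist (P Q : Measure ℝ) : ℝ≥0∞ :=
  ⨆ h : {h : ℝ → ℝ // LipschitzWith 1 h}, ENNReal.ofReal |∫ x, h.1 x ∂P - ∫ x, h.1 x ∂Q|

end

noncomputable section

/-! Stein's method, carried out around the kink of the drift. Shifting by ζ, dividing rates by `mu`
and setting δ = 1/√R, a = `alpha / mu` turns the diffusion drift into D(u) = b + u⁻ - a u⁺. Its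
stationary variable is called V below, with unnormalized density w, w' = D w. The chain becomes a
law p on the lattice u_k = δ(k - n) with p_{k+1}(1 - δ D_{k+1}) = p_k, where D_k = D(u_k)
(`IsKinkChain`). Only a, b, δ matter, and the bounds must be uniform in b and stay bounded as a → 0.

The recursion for p is detailed balance. Lower bounds on the transition function for at most one
jump, differentiated at t = 0, make p superinvariant; summability then forces zero net flux through
every edge (`detailed_balance_of_superinvariant`).

The Stein equation g' + D g = E h(V) - h is solved by `steinSol`. Summation by parts gives E[(1 - δ
D_k) g(u_k - δ) - g(u_k)] = 0. Interpolating across one cell and using the Stein equation once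
(`cell_estimate`) reduces the claim to bounding the mean of |g| (|D(x) - D_k|/δ + |D_k D(x)|) over
cells. No derivative of g has to be estimated, so neither the kink nor a merely Lipschitz h causes
trouble.

If a ≥ 1, then |g| ≤ 1 and E D² ≤ a suffice. If a ≤ 1, the general bound is only |g| ≤ 1/a and the
chain must compensate. Right of the kink, E[D²; k > n] ≤ a when b ≥ 0, and D²|g| is controlled
directly when b ≤ 0. Left of the kink, |g| ≤ 2 when b ≤ -1, and |g| ≤ 1 + e² E V⁺ when b ≥ -1; there
E V⁺ may be large, but P(k ≤ n) is then small, with product at most 20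
(`mean_indicator_mul_kinkPosMean_le`). -/

/-! ### Stationarity implies detailed balance -/

theorem birthDeathIter_one (b d : ℕ → ℝ) (t : ℝ) (i j : ℕ) :
    birthDeathIter b d 1 t i j =
      if i = j then ENNReal.ofReal (Real.exp (-(b i + d i) * t)) else 0 := by
  simp [birthDeathIter]

theorem le_birthDeathTransition_self (b d : ℕ → ℝ) (t : ℝ) (j : ℕ) :
    ENNReal.ofReal (Real.exp (-(b j + d j) * t)) ≤ birthDeathTransition b d t j j := by
  refine le_trans ?_ (le_iSup (fun m => birthDeathIter b d m t j j) 1)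
  rw [birthDeathIter_one]
  simp

/-- Lower bound for a one-jump transition probability, `c` being the rate of the jump. -/
theorem ofReal_mul_exp_le_lintegral {c Q qi qj t : ℝ} (hc : 0 ≤ c)
    (hi : qi ≤ Q) (hj : qj ≤ Q) :
    ENNReal.ofReal (c * t * Real.exp (-Q * t)) ≤
      ∫⁻ s in Set.Icc 0 t, ENNReal.ofReal (Real.exp (-qi * s)) *
        (ENNReal.ofReal c * ENNReal.ofReal (Real.exp (-qj * (t - s)))) := by
  calc ENNReal.ofReal (c * t * Real.exp (-Q * t))
      = ∫⁻ _ in Set.Icc (0 : ℝ) t, ENNReal.ofReal (c * Real.exp (-Q * t)) := by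
        rw [setLIntegral_const, Real.volume_Icc, ← ENNReal.ofReal_mul (by positivity)]
        congr 1; ring
    _ ≤ _ := by
        refine setLIntegral_mono' measurableSet_Icc fun s hs => ?_
        rw [← ENNReal.ofReal_mul hc, ← ENNReal.ofReal_mul (Real.exp_pos _).le]
        refine ENNReal.ofReal_le_ofReal ?_
        have : Real.exp (-Q * t) ≤ Real.exp (-qi * s) * Real.exp (-qj * (t - s)) := by
          rw [← Real.exp_add]
          refine Real.exp_le_exp.2 ?_
          nlinarith [mul_le_mul_of_nonneg_right hi hs.1,
            mul_le_mul_of_nonneg_right hj (sub_nonneg.2 hs.2)]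
        calc c * Real.exp (-Q * t)
            ≤ c * (Real.exp (-qi * s) * Real.exp (-qj * (t - s))) :=
              mul_le_mul_of_nonneg_left this hc
          _ = _ := by ring

/-- Lower bounds for zero or one jump are all that is used about the transition function. The common
bound `Q` on the two exit rates disappears in the limit t → 0. -/
theorem le_birthDeathTransition_up (b d : ℕ → ℝ) {Q t : ℝ} (i : ℕ) (hb : 0 ≤ b i)
    (hi : b i + d i ≤ Q) (hj : b (i + 1) + d (i + 1) ≤ Q) :
    ENNReal.ofReal (b i * t * Real.exp (-Q * t)) ≤ birthDeathTransition b d t i (i + 1) := by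
  refine le_trans ?_ (le_iSup (fun m => birthDeathIter b d m t i (i + 1)) 2)
  refine (ofReal_mul_exp_le_lintegral hb hi hj).trans ?_
  rw [show (2 : ℕ) = 1 + 1 from rfl, birthDeathIter]
  refine le_trans (lintegral_mono fun s => ?_) le_add_self
  rw [birthDeathIter_one, if_pos rfl]
  gcongr
  exact le_self_add

theorem le_birthDeathTransition_down (b d : ℕ → ℝ) {Q t : ℝ} (j : ℕ) (hd : 0 ≤ d (j + 1))
    (hi : b (j + 1) + d (j + 1) ≤ Q) (hj : b j + d j ≤ Q) :
    ENNReal.ofReal (d (j + 1) * t * Real.exp (-Q * t)) ≤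
      birthDeathTransition b d t (j + 1) j := by
  refine le_trans ?_ (le_iSup (fun m => birthDeathIter b d m t (j + 1) j) 2)
  refine (ofReal_mul_exp_le_lintegral hd hi hj).trans ?_
  rw [show (2 : ℕ) = 1 + 1 from rfl, birthDeathIter]
  refine le_trans (lintegral_mono fun s => ?_) le_add_self
  rw [birthDeathIter_one b d _ (j + 1 - 1) j, if_pos (by simp)]
  gcongr
  exact le_add_self

/-- An inequality valid to first order in small times passes to the rates. -/
theorem rate_le_of_forall_exp {x q V Q : ℝ} (hx : 0 ≤ x)
    (H : ∀ t : ℝ, 0 < t → x * Real.exp (-q * t) + V * t * Real.exp (-Q * t) ≤ x) :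
    V ≤ x * q := by
  have h1 : ∀ t : ℝ, 0 < t → V * Real.exp (-Q * t) ≤ x * q := by
    intro t ht
    have h2 := H t ht
    have h3 : -q * t + 1 ≤ Real.exp (-q * t) := Real.add_one_le_exp _
    have h4 := mul_le_mul_of_nonneg_left h3 hx
    have : V * Real.exp (-Q * t) * t ≤ x * q * t := by nlinarith
    exact le_of_mul_le_mul_right this ht
  have h5 : Filter.Tendsto (fun t : ℝ => V * Real.exp (-Q * t)) (nhdsWithin 0 (Set.Ioi 0))
      (nhds (V * Real.exp (-Q * 0))) :=
    (Continuous.tendsto (by fun_prop) 0).mono_left nhdsWithin_le_nhds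
  have h6 := le_of_tendsto h5 (Filter.eventually_of_mem self_mem_nhdsWithin fun t ht => h1 t ht)
  simpa using h6

/-- A nonnegative summable sequence which is superinvariant for a birth-death generator with
bounded birth rates is reversible. -/
theorem detailed_balance_of_superinvariant {lam : ℝ} {d x : ℕ → ℝ}
    (hx : Summable x)
    (h0 : x 1 * d 1 ≤ x 0 * lam)
    (hs : ∀ j, x j * lam + x (j + 2) * d (j + 2) ≤ x (j + 1) * (lam + d (j + 1)))
    (hd : ∀ j, 0 ≤ x j * d j) (j : ℕ) :
    x (j + 1) * d (j + 1) = x j * lam := by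
  -- `J j` is the net flux from j to j + 1. It is nondecreasing by superinvariance, nonnegative at
  -- 0, and at most x k * lam → 0 for every later k; hence it vanishes.
  let J : ℕ → ℝ := fun j => x j * lam - x (j + 1) * d (j + 1)
  have hmono : Monotone J := monotone_nat_of_le_succ fun j => by
    have := hs j
    simp only [J]
    linarith
  have hle : ∀ j, J j ≤ 0 := by
    intro j
    have ht : Filter.Tendsto (fun k => x k * lam) Filter.atTop (nhds 0) := by
      simpa using hx.tendsto_atTop_zero.mul_const lam
    refine ge_of_tendsto ht ?_
    filter_upwards [Filter.eventually_ge_atTop j] with k hk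
    have h1 := hmono hk
    have h2 := hd (k + 1)
    simp only [J] at h1 ⊢
    linarith
  have h1 : 0 ≤ J 0 := by simp only [J, zero_add]; linarith
  have h2 := hmono (Nat.zero_le j)
  have h3 := hle j
  simp only [J] at h1 h2 h3
  linarith

theorem departureRate_nonneg {n : ℕ} {mu alpha : ℝ} (hmu : 0 < mu) (ha : 0 < alpha) (k : ℕ) :
    0 ≤ departureRate n mu alpha k := by
  unfold departureRate
  positivity

theorem departureRate_zero (n : ℕ) (mu alpha : ℝ) : departureRate n mu alpha (0 : ℕ) = 0 := by
  simp [departureRate]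

theorem hasSum_real_singleton (p : Measure ℕ) [IsProbabilityMeasure p] : HasSum (fun k => p.real {k}) 1 := by
  have h1 : ∑' k, p {k} = 1 := by
    have := measure_univ (μ := p)
    rw [← Measure.tsum_indicator_apply_singleton p Set.univ MeasurableSet.univ] at this
    simpa using this
  have h2 : Summable fun k => p.real {k} := ENNReal.summable_toReal (by rw [h1]; simp)
  refine h2.hasSum_iff.2 ?_
  have h3 := ENNReal.tsum_toReal_eq (f := fun k => p {k}) (fun k => measure_ne_top p _)
  rw [h1] at h3
  simpa [Measure.real] using h3.symm

/-- A stationary distribution of the Erlang-A system satisfies detailed balance. -/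
theorem IsErlangAStationary.detailed_balance {n : ℕ} {lam mu alpha : ℝ} (hlam : 0 < lam)
    (hmu : 0 < mu) (ha : 0 < alpha) {p : Measure ℕ} (hp : IsErlangAStationary n lam mu alpha p)
    (k : ℕ) :
    p.real {k + 1} * departureRate n mu alpha (k + 1 : ℕ) = p.real {k} * lam := by
  obtain ⟨hprob, hst⟩ := hp
  have hsum := (hasSum_real_singleton p).summable
  have hof : ∀ k, p {k} = ENNReal.ofReal (p.real {k}) := fun k => by simp [Measure.real]
  let d : ℕ → ℝ := fun k => departureRate n mu alpha k
  have hd : ∀ k, 0 ≤ d k := departureRate_nonneg hmu ha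
  -- Stationarity enters only through this inequality, with `s` consisting of j and its neighbours.
  have hP : ∀ t : ℝ, 0 ≤ t → ∀ (j : ℕ) (s : Finset ℕ),
      ∑ i ∈ s, p {i} * birthDeathTransition (fun _ => lam) d t i j ≤ p {j} := by
    intro t ht j s
    rw [← hst t ht j]
    exact ENNReal.sum_le_tsum s
  refine detailed_balance_of_superinvariant (d := d) (x := fun k => p.real {k}) hsum
    ?_ ?_ (fun j => mul_nonneg measureReal_nonneg (hd j)) k
  · have h0 : d 0 = 0 := departureRate_zero n mu alpha
    have := rate_le_of_forall_exp (x := p.real {0}) (q := lam + d 0) (V := p.real {1} * d 1)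
      (Q := lam + d 0 + (lam + d 1)) measureReal_nonneg ?_
    · simpa [h0] using this
    intro t ht
    have h1 := hP t ht.le 0 {0, 1}
    rw [Finset.sum_pair (by simp)] at h1
    have h2 := le_birthDeathTransition_self (fun _ => lam) d t 0
    have h3 := le_birthDeathTransition_down (fun _ => lam) d (t := t) (Q := lam + d 0 + (lam + d 1)) 0
      (hd _) (by have := hd 0; simp only [zero_add]; linarith)
        (by have := hd 1; linarith)
    have h4 := (add_le_add (mul_le_mul_right h2 (p {0})) (mul_le_mul_right h3 (p {1}))).trans h1
    rw [hof 0, hof 1, ← ENNReal.ofReal_mul measureReal_nonneg,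
      ← ENNReal.ofReal_mul measureReal_nonneg, ← ENNReal.ofReal_add
        (by positivity) (by have := hd 1; simp only [zero_add]; positivity),
      ENNReal.ofReal_le_ofReal_iff measureReal_nonneg] at h4
    simp only [zero_add] at h4
    linarith
  · intro j
    have := rate_le_of_forall_exp (x := p.real {j + 1}) (q := lam + d (j + 1))
      (V := p.real {j} * lam + p.real {j + 2} * d (j + 2))
      (Q := lam + d j + (lam + d (j + 1)) + (lam + d (j + 2))) measureReal_nonneg ?_
    · exact this
    intro t ht
    set Q := lam + d j + (lam + d (j + 1)) + (lam + d (j + 2)) with hQ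
    have e0 := hd j
    have e1 := hd (j + 1)
    have e2 := hd (j + 2)
    have h1 := hP t ht.le (j + 1) {j, j + 1, j + 2}
    rw [Finset.sum_insert (by simp), Finset.sum_pair (by simp)] at h1
    have h2 := le_birthDeathTransition_self (fun _ => lam) d t (j + 1)
    have h3 := le_birthDeathTransition_down (fun _ => lam) d (t := t) (Q := Q) (j + 1)
      (hd _) (by simp only [add_assoc]; norm_num; linarith) (by linarith)
    have h3' := le_birthDeathTransition_up (fun _ => lam) d (t := t) (Q := Q) j
      hlam.le (by linarith) (by linarith)
    have h4 := (add_le_add (mul_le_mul_right h3' (p {j})) (add_le_add (mul_le_mul_right h2 (p {j + 1}))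
      (mul_le_mul_right h3 (p {j + 2})))).trans h1
    rw [hof j, hof (j + 1), hof (j + 2), ← ENNReal.ofReal_mul measureReal_nonneg,
      ← ENNReal.ofReal_mul measureReal_nonneg, ← ENNReal.ofReal_mul measureReal_nonneg,
      ← ENNReal.ofReal_add (by positivity) (by positivity),
      ← ENNReal.ofReal_add (by positivity) (by positivity),
      ENNReal.ofReal_le_ofReal_iff measureReal_nonneg] at h4
    have e3 : d (j + 1 + 1) = d (j + 2) := rfl
    rw [e3] at h4
    linarith

/-! ### The rescaled chain and its moments -/

/-- The piecewise linear drift with slope `-1` left of the origin and `-a` right of it. -/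
def kinkDrift (a b u : ℝ) : ℝ := b + max (-u) 0 - a * max u 0

/-- The drift at the lattice point `δ (k - n)`. -/
def latticeDrift (a b δ : ℝ) (n k : ℕ) : ℝ := kinkDrift a b (δ * ((k : ℝ) - n))

theorem kinkDrift_of_nonpos {a b u : ℝ} (hu : u ≤ 0) : kinkDrift a b u = b - u := by
  rw [kinkDrift, max_eq_left (by linarith), max_eq_right hu]; ring

theorem kinkDrift_of_nonneg {a b u : ℝ} (hu : 0 ≤ u) : kinkDrift a b u = b - a * u := by
  rw [kinkDrift, max_eq_right (by linarith), max_eq_left hu]; ring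

theorem kinkDrift_antitone {a b : ℝ} (ha : 0 ≤ a) : Antitone (kinkDrift a b) := by
  intro x y hxy
  unfold kinkDrift
  have h1 : max (-y) 0 ≤ max (-x) 0 := max_le_max (by linarith) le_rfl
  have h2 : max x 0 ≤ max y 0 := max_le_max hxy le_rfl
  nlinarith

/-- Growth of order at most `k ^ m`. -/
def PolyBdd (m : ℕ) (f : ℕ → ℝ) : Prop := ∃ C : ℝ, 0 ≤ C ∧ ∀ k : ℕ, |f k| ≤ C * ((k : ℝ) + 1) ^ m

namespace PolyBdd

variable {m l : ℕ} {f g : ℕ → ℝ}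

theorem of_abs_le (hg : PolyBdd m g) (h : ∀ k, |f k| ≤ |g k|) : PolyBdd m f := by
  obtain ⟨C, hC, hg⟩ := hg
  exact ⟨C, hC, fun k => (h k).trans (hg k)⟩

theorem mono (hf : PolyBdd m f) (hml : m ≤ l) : PolyBdd l f := by
  obtain ⟨C, hC, hf⟩ := hf
  refine ⟨C, hC, fun k => (hf k).trans ?_⟩
  gcongr
  linarith [(Nat.cast_nonneg k : (0 : ℝ) ≤ k)]

theorem const (c : ℝ) : PolyBdd m fun _ => c := by
  refine PolyBdd.mono ⟨|c|, abs_nonneg c, fun k => ?_⟩ (Nat.zero_le m)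
  simp

theorem add (hf : PolyBdd m f) (hg : PolyBdd m g) : PolyBdd m fun k => f k + g k := by
  obtain ⟨C, hC, hf⟩ := hf
  obtain ⟨D, hD, hg⟩ := hg
  refine ⟨C + D, by positivity, fun k => (abs_add_le _ _).trans ?_⟩
  rw [add_mul]
  exact add_le_add (hf k) (hg k)

theorem mul (hf : PolyBdd m f) (hg : PolyBdd l g) : PolyBdd (m + l) fun k => f k * g k := by
  obtain ⟨C, hC, hf⟩ := hf
  obtain ⟨D, hD, hg⟩ := hg
  refine ⟨C * D, by positivity, fun k => ?_⟩
  rw [abs_mul, pow_add]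
  calc |f k| * |g k| ≤ (C * ((k : ℝ) + 1) ^ m) * (D * ((k : ℝ) + 1) ^ l) :=
        mul_le_mul (hf k) (hg k) (abs_nonneg _) (by positivity)
    _ = _ := by ring

theorem const_mul (c : ℝ) (hf : PolyBdd m f) : PolyBdd m fun k => c * f k := by
  simpa using (PolyBdd.const (m := 0) c).mul hf

theorem neg (hf : PolyBdd m f) : PolyBdd m fun k => -f k :=
  hf.of_abs_le fun k => by simp

theorem sub (hf : PolyBdd m f) (hg : PolyBdd m g) : PolyBdd m fun k => f k - g k := by
  simpa [sub_eq_add_neg] using hf.add hg.neg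

theorem abs (hf : PolyBdd m f) : PolyBdd m fun k => |f k| :=
  hf.of_abs_le fun k => by simp

theorem max_zero (hf : PolyBdd m f) : PolyBdd m fun k => max (f k) 0 :=
  hf.of_abs_le fun k => by
    rw [abs_of_nonneg (le_max_right _ _)]
    exact max_le (le_abs_self _) (abs_nonneg _)

theorem indicator (P : ℕ → Prop) [DecidablePred P] (hf : PolyBdd m f) :
    PolyBdd m fun k => if P k then f k else 0 :=
  hf.of_abs_le fun k => by split_ifs <;> simp

theorem sq (hf : PolyBdd 1 f) : PolyBdd 2 fun k => f k ^ 2 := by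
  simpa [pow_two] using hf.mul hf

theorem lattice (δ : ℝ) (n : ℕ) : PolyBdd 1 fun k => δ * ((k : ℝ) - n) := by
  refine PolyBdd.const_mul δ (PolyBdd.sub ⟨1, zero_le_one, fun k => ?_⟩ (PolyBdd.const _))
  rw [abs_of_nonneg (Nat.cast_nonneg k)]
  linarith

theorem drift (a b δ : ℝ) (n : ℕ) : PolyBdd 1 (latticeDrift a b δ n) :=
  ((PolyBdd.const b).add (PolyBdd.lattice δ n).neg.max_zero).sub
    ((PolyBdd.lattice δ n).max_zero.const_mul a)

theorem shift (hf : PolyBdd m f) : PolyBdd m fun k => f (k + 1) := by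
  obtain ⟨C, hC, hf⟩ := hf
  refine ⟨C * 2 ^ m, by positivity, fun k => (hf (k + 1)).trans ?_⟩
  rw [mul_assoc, ← mul_pow]
  gcongr
  push_cast
  linarith [(Nat.cast_nonneg k : (0 : ℝ) ≤ k)]

end PolyBdd

/-- A reversible stationary law `p` of a birth-death chain on the lattice `δ (k - n)` whose scaled
drift is `kinkDrift a b`. -/
structure IsKinkChain (a b δ : ℝ) (n : ℕ) (p : ℕ → ℝ) : Prop where
  a_pos : 0 < a
  delta_pos : 0 < δ
  delta_le : δ ≤ 1
  nonneg : ∀ k, 0 ≤ p k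
  hasSum : HasSum p 1
  -- For Erlang-A, 1 - δ D_k is the departure rate in state k divided by `lam`: `step` is detailed
  -- balance and `bot` says that nobody leaves state 0.
  step : ∀ k, p (k + 1) * (1 - δ * latticeDrift a b δ n (k + 1)) = p k
  bot : δ * latticeDrift a b δ n 0 = 1

/-- The sum of `f` against the weights `p`. -/
def mean (p f : ℕ → ℝ) : ℝ := ∑' k, p k * f k

theorem mean_const_mul (p f : ℕ → ℝ) (c : ℝ) : mean p (fun k => c * f k) = c * mean p f := by
  unfold mean
  rw [← tsum_mul_left]
  exact tsum_congr fun k => by ring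

theorem mean_neg (p f : ℕ → ℝ) : mean p (fun k => -f k) = -mean p f := by
  simpa using mean_const_mul p f (-1)

namespace IsKinkChain

variable {a b δ : ℝ} {n : ℕ} {p f g : ℕ → ℝ}

theorem drift_of_le (H : IsKinkChain a b δ n p) {k : ℕ} (hk : k ≤ n) :
    latticeDrift a b δ n k = b - δ * ((k : ℝ) - n) := by
  refine kinkDrift_of_nonpos ?_
  have : (k : ℝ) ≤ n := by exact_mod_cast hk
  nlinarith [H.delta_pos]

theorem drift_of_ge (H : IsKinkChain a b δ n p) {k : ℕ} (hk : n ≤ k) :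
    latticeDrift a b δ n k = b - a * (δ * ((k : ℝ) - n)) := by
  refine kinkDrift_of_nonneg ?_
  have : (n : ℝ) ≤ k := by exact_mod_cast hk
  nlinarith [H.delta_pos]

theorem summable_pow (H : IsKinkChain a b δ n p) (m : ℕ) :
    Summable fun k => p k * ((k : ℝ) + 1) ^ m := by
  refine summable_of_ratio_norm_eventually_le (r := 1 / 2) (by norm_num) ?_
  -- Beyond `N` the factor 1 - δ D_{k+1} exceeds 2^(m+1): 2^m pays for the growth of (k + 1)^m and
  -- the remaining 2 gives the ratio 1/2.
  obtain ⟨N, hN⟩ := exists_nat_gt ((2 ^ (m + 1) - 1 + δ * b) / (a * δ ^ 2) + n)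
  have ha := H.a_pos
  have hδ := H.delta_pos
  filter_upwards [Filter.eventually_ge_atTop (max N n)] with k hk
  have hkN : N ≤ k := (le_max_left _ _).trans hk
  have hkn : n ≤ k := (le_max_right _ _).trans hk
  have h1 : (2 : ℝ) ^ (m + 1) ≤ 1 - δ * latticeDrift a b δ n (k + 1) := by
    rw [H.drift_of_ge (by omega)]
    have h2 : (2 ^ (m + 1) - 1 + δ * b) / (a * δ ^ 2) < (k : ℝ) + 1 - n := by
      have : (N : ℝ) ≤ k := by exact_mod_cast hkN
      linarith
    rw [div_lt_iff₀ (by positivity)] at h2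
    push_cast
    linarith
  have hp := H.nonneg (k + 1)
  have hp' := H.nonneg k
  rw [Real.norm_of_nonneg (by positivity), Real.norm_of_nonneg (by positivity), ← H.step k]
  have h3 : ((k + 1 : ℕ) + 1 : ℝ) ^ m ≤ 2 ^ m * ((k : ℝ) + 1) ^ m := by
    rw [← mul_pow]
    gcongr
    push_cast
    linarith [(Nat.cast_nonneg k : (0 : ℝ) ≤ k)]
  calc p (k + 1) * ((k + 1 : ℕ) + 1 : ℝ) ^ m ≤ p (k + 1) * (2 ^ m * ((k : ℝ) + 1) ^ m) := by gcongr
    _ = 1 / 2 * (p (k + 1) * 2 ^ (m + 1) * ((k : ℝ) + 1) ^ m) := by rw [pow_succ]; ring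
    _ ≤ _ := by gcongr

theorem summable {m : ℕ} (H : IsKinkChain a b δ n p) (hf : PolyBdd m f) :
    Summable fun k => p k * f k := by
  obtain ⟨C, hC, hf⟩ := hf
  refine Summable.of_norm_bounded (g := fun k => C * (p k * ((k : ℝ) + 1) ^ m))
    ((H.summable_pow m).mul_left C) fun k => ?_
  rw [norm_mul, Real.norm_of_nonneg (H.nonneg k), Real.norm_eq_abs]
  calc p k * |f k| ≤ p k * (C * ((k : ℝ) + 1) ^ m) := mul_le_mul_of_nonneg_left (hf k) (H.nonneg k)
    _ = _ := by ring

theorem mean_add (H : IsKinkChain a b δ n p) (hf : PolyBdd 2 f) (hg : PolyBdd 2 g) :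
    mean p (fun k => f k + g k) = mean p f + mean p g := by
  unfold mean
  rw [← (H.summable hf).tsum_add (H.summable hg)]
  exact tsum_congr fun k => by ring

theorem mean_sub (H : IsKinkChain a b δ n p) (hf : PolyBdd 2 f) (hg : PolyBdd 2 g) :
    mean p (fun k => f k - g k) = mean p f - mean p g := by
  unfold mean
  rw [← (H.summable hf).tsum_sub (H.summable hg)]
  exact tsum_congr fun k => by ring

theorem mean_const (H : IsKinkChain a b δ n p) (c : ℝ) : mean p (fun _ => c) = c := by
  unfold mean
  rw [tsum_mul_right, H.hasSum.tsum_eq, one_mul]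

theorem mean_mono (H : IsKinkChain a b δ n p) (hf : PolyBdd 2 f) (hg : PolyBdd 2 g)
    (h : ∀ k, f k ≤ g k) : mean p f ≤ mean p g :=
  (H.summable hf).tsum_le_tsum (fun k => mul_le_mul_of_nonneg_left (h k) (H.nonneg k))
    (H.summable hg)

theorem mean_nonneg (H : IsKinkChain a b δ n p) (h : ∀ k, 0 ≤ f k) : 0 ≤ mean p f :=
  tsum_nonneg fun k => mul_nonneg (H.nonneg k) (h k)

/-- Summation by parts: the generator characterization of the stationary law. -/
theorem mean_drift_mul (H : IsKinkChain a b δ n p) (hg : PolyBdd 1 g) :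
    mean p (fun k => latticeDrift a b δ n k * g k) = -mean p (fun k => (g (k + 1) - g k) / δ) := by
  have hδ := H.delta_pos
  have s1 : Summable fun k => p k * g k := H.summable hg
  have s2 : Summable fun k => p k * g (k + 1) := H.summable hg.shift
  have s3 : Summable fun k => p k * (latticeDrift a b δ n k * g k) :=
    H.summable ((PolyBdd.drift a b δ n).mul hg)
  have s4 : Summable fun k => p k * (1 - δ * latticeDrift a b δ n k) * g k := by
    refine (s1.sub (s3.mul_left δ)).congr fun k => ?_
    ring
  -- Index shift; the boundary term k = 0 drops out by `bot`.
  have e1 : ∑' k, p k * (1 - δ * latticeDrift a b δ n k) * g k = ∑' k, p k * g (k + 1) := by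
    rw [s4.tsum_eq_zero_add, H.bot, sub_self, mul_zero, zero_mul, zero_add]
    exact tsum_congr fun k => by rw [H.step]
  have e2 : ∑' k, p k * (1 - δ * latticeDrift a b δ n k) * g k =
      (∑' k, p k * g k) - δ * mean p (fun k => latticeDrift a b δ n k * g k) := by
    unfold mean
    rw [← tsum_mul_left, ← s1.tsum_sub (s3.mul_left δ)]
    exact tsum_congr fun k => by ring
  have e3 : mean p (fun k => (g (k + 1) - g k) / δ) =
      ((∑' k, p k * g (k + 1)) - ∑' k, p k * g k) / δ := by
    unfold mean
    rw [← s2.tsum_sub s1, ← tsum_div_const]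
    exact tsum_congr fun k => by ring
  rw [e3]
  field_simp
  linarith

theorem mean_drift (H : IsKinkChain a b δ n p) : mean p (latticeDrift a b δ n) = 0 := by
  have := H.mean_drift_mul (g := fun _ => 1) (PolyBdd.const 1)
  simpa [mean] using this

/-- The test function u⁺ has difference quotient 1 on the steps from k ≥ n and 0 elsewhere. Its
companion u⁻, used next, has quotient -1 on the steps from k < n. -/
theorem mean_drift_mul_pos (H : IsKinkChain a b δ n p) :
    mean p (fun k => latticeDrift a b δ n k * max (δ * ((k : ℝ) - n)) 0) =
      -mean p (fun k => if n ≤ k then 1 else 0) := by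
  rw [H.mean_drift_mul (PolyBdd.lattice δ n).max_zero]
  congr 2
  ext k
  have hδ := H.delta_pos
  push_cast
  split_ifs with h
  · have h1 : (n : ℝ) ≤ k := by exact_mod_cast h
    rw [max_eq_left (by nlinarith), max_eq_left (by nlinarith)]
    field_simp; ring
  · have h1 : (k : ℝ) + 1 ≤ n := by exact_mod_cast not_le.1 h
    rw [max_eq_right (by nlinarith), max_eq_right (by nlinarith)]
    simp

theorem mean_drift_mul_neg (H : IsKinkChain a b δ n p) :
    mean p (fun k => latticeDrift a b δ n k * max (-(δ * ((k : ℝ) - n))) 0) =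
      mean p (fun k => if k < n then 1 else 0) := by
  rw [H.mean_drift_mul (PolyBdd.lattice δ n).neg.max_zero, ← mean_neg]
  congr 1
  ext k
  have hδ := H.delta_pos
  push_cast
  split_ifs with h
  · have h1 : (k : ℝ) + 1 ≤ n := by exact_mod_cast h
    rw [max_eq_left (by nlinarith), max_eq_left (by nlinarith)]
    field_simp; ring
  · have h1 : (n : ℝ) ≤ k := by exact_mod_cast not_lt.1 h
    rw [max_eq_right (by nlinarith), max_eq_right (by nlinarith)]
    simp

theorem polyBdd_indicator (P : ℕ → Prop) [DecidablePred P] {m : ℕ} :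
    PolyBdd m fun k => if P k then (1 : ℝ) else 0 :=
  (PolyBdd.const 1).indicator P

theorem mean_indicator_le_one (H : IsKinkChain a b δ n p) (P : ℕ → Prop) [DecidablePred P] :
    mean p (fun k => if P k then (1 : ℝ) else 0) ≤ 1 := by
  conv_rhs => rw [← H.mean_const 1]
  exact H.mean_mono (polyBdd_indicator P) (PolyBdd.const 1) fun k => by split_ifs <;> norm_num

/-- Expanding one factor as b + u⁻ - a u⁺ and testing against 1, u⁻, u⁺ gives E D² = P(k < n) + a
P(k ≥ n), in which b no longer appears. -/
theorem mean_drift_sq (H : IsKinkChain a b δ n p) :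
    mean p (fun k => latticeDrift a b δ n k ^ 2) ≤ max 1 a := by
  have hD := PolyBdd.drift a b δ n
  have hpos := (hD.mul (PolyBdd.lattice δ n).max_zero)
  have hneg := (hD.mul (PolyBdd.lattice δ n).neg.max_zero)
  have e : (fun k => latticeDrift a b δ n k ^ 2) = fun k =>
      (b * latticeDrift a b δ n k +
        latticeDrift a b δ n k * max (-(δ * ((k : ℝ) - n))) 0) -
        a * (latticeDrift a b δ n k * max (δ * ((k : ℝ) - n)) 0) := by
    ext k
    rw [pow_two]
    conv_lhs => arg 2; rw [latticeDrift, kinkDrift]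
    ring
  rw [e, H.mean_sub (((hD.mono one_le_two).const_mul b).add hneg) (hpos.const_mul a),
    H.mean_add ((hD.mono one_le_two).const_mul b) hneg, mean_const_mul, mean_const_mul,
    H.mean_drift, H.mean_drift_mul_neg, H.mean_drift_mul_pos, ← neg_mul_eq_mul_neg, sub_neg_eq_add,
    mul_zero, zero_add, ← mean_const_mul,
    ← H.mean_add (polyBdd_indicator _) ((polyBdd_indicator _).const_mul a)]
  conv_rhs => rw [← H.mean_const (max 1 a)]
  refine H.mean_mono ((polyBdd_indicator _).add ((polyBdd_indicator _).const_mul a))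
    (PolyBdd.const _) fun k => ?_
  rcases lt_or_ge k n with h | h
  · simp [h, not_le.2 h]
  · simp [h, not_lt.2 h]

end IsKinkChain

/-! ### Integrals against the diffusion density -/

/-- Continuous functions of at most linear growth. -/
def LinGrowth (f : ℝ → ℝ) : Prop := Continuous f ∧ ∃ C : ℝ, 0 ≤ C ∧ ∀ u, |f u| ≤ C * (1 + |u|)

namespace LinGrowth

variable {f g : ℝ → ℝ}

theorem const (c : ℝ) : LinGrowth fun _ => c :=
  ⟨continuous_const, |c|, abs_nonneg c, fun u => by
    nlinarith [abs_nonneg c, abs_nonneg u, mul_nonneg (abs_nonneg c) (abs_nonneg u)]⟩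

theorem id : LinGrowth fun u => u :=
  ⟨continuous_id, 1, zero_le_one, fun u => by linarith⟩

theorem add (hf : LinGrowth f) (hg : LinGrowth g) : LinGrowth fun u => f u + g u := by
  obtain ⟨hf, C, hC, hfC⟩ := hf
  obtain ⟨hg, D, hD, hgD⟩ := hg
  refine ⟨hf.add hg, C + D, by positivity, fun u => (abs_add_le _ _).trans ?_⟩
  rw [add_mul]
  exact add_le_add (hfC u) (hgD u)

theorem const_mul (c : ℝ) (hf : LinGrowth f) : LinGrowth fun u => c * f u := by
  obtain ⟨hf, C, hC, hfC⟩ := hf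
  refine ⟨hf.const_mul c, |c| * C, by positivity, fun u => ?_⟩
  rw [abs_mul, mul_assoc]
  exact mul_le_mul_of_nonneg_left (hfC u) (abs_nonneg c)

theorem neg (hf : LinGrowth f) : LinGrowth fun u => -f u := by
  simpa using hf.const_mul (-1)

theorem sub (hf : LinGrowth f) (hg : LinGrowth g) : LinGrowth fun u => f u - g u := by
  simpa [sub_eq_add_neg] using hf.add hg.neg

theorem max_zero (hf : LinGrowth f) : LinGrowth fun u => max (f u) 0 := by
  obtain ⟨hf, C, hC, hfC⟩ := hf
  refine ⟨hf.max continuous_const, C, hC, fun u => le_trans ?_ (hfC u)⟩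
  rw [abs_of_nonneg (le_max_right _ _)]
  exact max_le (le_abs_self _) (abs_nonneg _)

theorem of_lipschitz (hf : ∀ x y, |f x - f y| ≤ |x - y|) : LinGrowth f := by
  refine ⟨(LipschitzWith.of_dist_le_mul (K := 1) fun x y => by
    simpa [Real.dist_eq] using hf x y).continuous, |f 0| + 1, by positivity, fun u => ?_⟩
  have h1 := hf u 0
  rw [sub_zero] at h1
  have h2 : |f u| ≤ |f 0| + |u| := by
    have := abs_add_le (f u - f 0) (f 0)
    rw [sub_add_cancel] at this
    linarith
  nlinarith [abs_nonneg u, abs_nonneg (f 0), mul_nonneg (abs_nonneg u) (abs_nonneg (f 0))]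

theorem kinkDrift (a b : ℝ) : LinGrowth (kinkDrift a b) :=
  ((LinGrowth.const b).add LinGrowth.id.neg.max_zero).sub (LinGrowth.id.max_zero.const_mul a)

end LinGrowth

/-- The unnormalized density with logarithmic derivative `kinkDrift a b`. -/
def kinkWeight (a b u : ℝ) : ℝ :=
  Real.exp (b * u - max (-u) 0 ^ 2 / 2 - a * (max u 0 ^ 2 / 2))

theorem kinkWeight_pos (a b u : ℝ) : 0 < kinkWeight a b u := Real.exp_pos _

theorem kinkWeight_zero (a b : ℝ) : kinkWeight a b 0 = 1 := by simp [kinkWeight]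

theorem kinkWeight_of_nonpos {a b u : ℝ} (hu : u ≤ 0) :
    kinkWeight a b u = Real.exp (b * u - u ^ 2 / 2) := by
  rw [kinkWeight, max_eq_left (by linarith), max_eq_right hu]
  congr 1; ring

theorem hasDerivAt_max_zero_sq (u : ℝ) :
    HasDerivAt (fun u : ℝ => max u 0 ^ 2 / 2) (max u 0) u := by
  rcases lt_trichotomy u 0 with h | rfl | h
  · rw [max_eq_right h.le]
    refine (hasDerivAt_const u (0 : ℝ)).congr_of_eventuallyEq ?_
    filter_upwards [Iio_mem_nhds h] with v hv
    rw [max_eq_right (le_of_lt hv)]; simp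
  -- At the kink, being O(x²) already gives derivative 0.
  · have : (fun u : ℝ => max u 0 ^ 2 / 2) =O[nhds 0] fun x => ‖x - 0‖ ^ 2 := by
      refine Asymptotics.IsBigO.of_bound 1 (Filter.Eventually.of_forall fun x => ?_)
      rw [sub_zero, one_mul, Real.norm_of_nonneg (by positivity), Real.norm_of_nonneg (by positivity),
        Real.norm_eq_abs, sq_abs]
      rcases le_total x 0 with h | h
      · rw [max_eq_right h]; nlinarith [sq_nonneg x]
      · rw [max_eq_left h]; nlinarith [sq_nonneg x]
    have h := (this.hasFDerivAt (𝕜 := ℝ) one_lt_two).hasDerivAt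
    simpa using h
  · rw [max_eq_left h.le]
    have h1 : HasDerivAt (fun v : ℝ => v ^ 2 / 2) u u := by
      exact ((hasDerivAt_pow 2 u).div_const 2).congr_deriv (by norm_num)
    refine h1.congr_of_eventuallyEq ?_
    filter_upwards [Ioi_mem_nhds h] with v hv
    rw [max_eq_left (le_of_lt hv)]

theorem hasDerivAt_kinkWeight (a b u : ℝ) :
    HasDerivAt (kinkWeight a b) (kinkDrift a b u * kinkWeight a b u) u := by
  have h1 := (hasDerivAt_id u).const_mul b
  have h2 : HasDerivAt (fun v : ℝ => max (-v) 0 ^ 2 / 2) (-max (-u) 0) u := by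
    have := (hasDerivAt_max_zero_sq (-u)).comp u (hasDerivAt_neg u)
    simpa [Function.comp_def] using this
  have h3 := (hasDerivAt_max_zero_sq u).const_mul a
  refine ((h1.sub h2).sub h3).exp.congr_deriv ?_
  simp only [kinkDrift, kinkWeight, Pi.sub_apply, id]
  ring

theorem continuous_kinkWeight (a b : ℝ) : Continuous (kinkWeight a b) :=
  continuous_iff_continuousAt.2 fun u => (hasDerivAt_kinkWeight a b u).continuousAt

/-- The quadratic part of the exponent is at most -c u²/2 with c = min 1 a. Half of it absorbs b u
by completing the square, and half of the rest absorbs the factor 1 + u². -/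
theorem exists_kinkWeight_bound {a : ℝ} (ha : 0 < a) (b : ℝ) :
    ∃ K c : ℝ, 0 < c ∧ 0 ≤ K ∧
      ∀ u, (1 + u ^ 2) * kinkWeight a b u ≤ K * Real.exp (-c * u ^ 2) := by
  set c := min 1 a with hc
  have hc0 : 0 < c := lt_min one_pos ha
  refine ⟨(1 + 8 / c) * Real.exp (b ^ 2 / c), c / 8, by positivity, by positivity, fun u => ?_⟩
  have h1 : b * u - max (-u) 0 ^ 2 / 2 - a * (max u 0 ^ 2 / 2) ≤ b ^ 2 / c - c / 4 * u ^ 2 := by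
    have h2 : b * u - max (-u) 0 ^ 2 / 2 - a * (max u 0 ^ 2 / 2) ≤ b * u - c * u ^ 2 / 2 := by
      rcases le_total u 0 with h | h
      · rw [max_eq_left (by linarith), max_eq_right h]
        nlinarith [min_le_left 1 a, sq_nonneg u]
      · rw [max_eq_right (by linarith), max_eq_left h]
        nlinarith [min_le_right 1 a, sq_nonneg u]
    have h3 : b * u ≤ b ^ 2 / c + c / 4 * u ^ 2 := by
      have : b ^ 2 / c + c / 4 * u ^ 2 - b * u = (b - c / 2 * u) ^ 2 / c := by field_simp; ring
      have := div_nonneg (sq_nonneg (b - c / 2 * u)) hc0.le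
      linarith
    linarith
  have h4 : 1 + u ^ 2 ≤ (1 + 8 / c) * Real.exp (c / 8 * u ^ 2) := by
    have h5 := Real.add_one_le_exp (c / 8 * u ^ 2)
    have h6 : 1 + u ^ 2 ≤ (1 + 8 / c) * (c / 8 * u ^ 2 + 1) := by
      have : (1 + 8 / c) * (c / 8 * u ^ 2 + 1) = 1 + u ^ 2 + (c / 8 * u ^ 2 + 8 / c) := by
        field_simp; ring
      rw [this]
      have : 0 ≤ c / 8 * u ^ 2 + 8 / c := by positivity
      linarith
    exact h6.trans (mul_le_mul_of_nonneg_left h5 (by positivity))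
  calc (1 + u ^ 2) * kinkWeight a b u
      ≤ ((1 + 8 / c) * Real.exp (c / 8 * u ^ 2)) * Real.exp (b ^ 2 / c - c / 4 * u ^ 2) :=
        mul_le_mul h4 (Real.exp_le_exp.2 h1) (Real.exp_pos _).le (by positivity)
    _ = _ := by
        rw [mul_assoc, mul_assoc, ← Real.exp_add, ← Real.exp_add]
        congr 2; ring

section Integrals

variable {a : ℝ} {b : ℝ} {f g : ℝ → ℝ}

theorem exists_mul_mul_kinkWeight_bound (ha : 0 < a) (b : ℝ) (hf : LinGrowth f) (hg : LinGrowth g) :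
    ∃ K c : ℝ, 0 < c ∧ ∀ u, ‖f u * g u * kinkWeight a b u‖ ≤ K * Real.exp (-c * u ^ 2) := by
  obtain ⟨K, c, hc, hK, H⟩ := exists_kinkWeight_bound ha b
  obtain ⟨-, C, hC, hf⟩ := hf
  obtain ⟨-, D, hD, hg⟩ := hg
  refine ⟨2 * C * D * K, c, hc, fun u => ?_⟩
  rw [norm_mul, norm_mul, Real.norm_of_nonneg (kinkWeight_pos a b u).le]
  have h1 : ‖f u‖ * ‖g u‖ ≤ 2 * C * D * (1 + u ^ 2) := by
    calc ‖f u‖ * ‖g u‖ ≤ (C * (1 + |u|)) * (D * (1 + |u|)) :=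
          mul_le_mul (hf u) (hg u) (norm_nonneg _) (by positivity)
      _ = C * D * (1 + |u|) ^ 2 := by ring
      _ ≤ C * D * (2 * (1 + u ^ 2)) := by
          refine mul_le_mul_of_nonneg_left ?_ (by positivity)
          nlinarith [sq_nonneg (1 - |u|), sq_abs u]
      _ = _ := by ring
  calc ‖f u‖ * ‖g u‖ * kinkWeight a b u ≤ 2 * C * D * (1 + u ^ 2) * kinkWeight a b u :=
        mul_le_mul_of_nonneg_right h1 (kinkWeight_pos a b u).le
    _ = 2 * C * D * ((1 + u ^ 2) * kinkWeight a b u) := by ring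
    _ ≤ 2 * C * D * (K * Real.exp (-c * u ^ 2)) :=
        mul_le_mul_of_nonneg_left (H u) (by positivity)
    _ = _ := by ring

theorem integrable_mul_mul_kinkWeight (ha : 0 < a) (b : ℝ) (hf : LinGrowth f) (hg : LinGrowth g) :
    Integrable fun u => f u * g u * kinkWeight a b u := by
  obtain ⟨K, c, hc, H⟩ := exists_mul_mul_kinkWeight_bound ha b hf hg
  exact ((integrable_exp_neg_mul_sq hc).const_mul K).mono'
    ((hf.1.mul hg.1).mul (continuous_kinkWeight a b)).aestronglyMeasurable
    (Filter.Eventually.of_forall H)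

theorem integrable_mul_kinkWeight (ha : 0 < a) (b : ℝ) (hf : LinGrowth f) :
    Integrable fun u => f u * kinkWeight a b u := by
  simpa using integrable_mul_mul_kinkWeight ha b (LinGrowth.const 1) hf

theorem integrable_kinkWeight (ha : 0 < a) (b : ℝ) : Integrable (kinkWeight a b) := by
  simpa using integrable_mul_kinkWeight ha b (LinGrowth.const 1)

theorem tendsto_exp_neg_mul_sq {l : Filter ℝ} {c : ℝ} (hc : 0 < c)
    (hl : Filter.Tendsto (fun u : ℝ => u ^ 2) l Filter.atTop) (K : ℝ) :
    Filter.Tendsto (fun u : ℝ => K * Real.exp (-c * u ^ 2)) l (nhds 0) := by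
  have h := Real.tendsto_exp_neg_atTop_nhds_zero.comp (hl.const_mul_atTop hc)
  simpa [Function.comp_def] using h.const_mul K

theorem tendsto_mul_kinkWeight_atTop (ha : 0 < a) (b : ℝ) (hf : LinGrowth f) :
    Filter.Tendsto (fun u => f u * kinkWeight a b u) Filter.atTop (nhds 0) := by
  obtain ⟨K, c, hc, H⟩ := exists_mul_mul_kinkWeight_bound ha b hf (LinGrowth.const 1)
  simp only [mul_one] at H
  exact squeeze_zero_norm H (tendsto_exp_neg_mul_sq hc (Filter.tendsto_pow_atTop two_ne_zero) K)

theorem tendsto_mul_kinkWeight_atBot (ha : 0 < a) (b : ℝ) (hf : LinGrowth f) :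
    Filter.Tendsto (fun u => f u * kinkWeight a b u) Filter.atBot (nhds 0) := by
  obtain ⟨K, c, hc, H⟩ := exists_mul_mul_kinkWeight_bound ha b hf (LinGrowth.const 1)
  simp only [mul_one] at H
  refine squeeze_zero_norm H (tendsto_exp_neg_mul_sq hc ?_ K)
  have := (Filter.tendsto_pow_atTop (α := ℝ) two_ne_zero).comp Filter.tendsto_neg_atBot_atTop
  simpa [Function.comp_def] using this

theorem integral_Ioi_drift (ha : 0 < a) (b x : ℝ) :
    ∫ y in Set.Ioi x, kinkDrift a b y * kinkWeight a b y = -kinkWeight a b x := by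
  rw [integral_Ioi_of_hasDerivAt_of_tendsto' (fun y _ => hasDerivAt_kinkWeight a b y)
    (integrable_mul_kinkWeight ha b (LinGrowth.kinkDrift a b)).integrableOn
    (by simpa using tendsto_mul_kinkWeight_atTop ha b (LinGrowth.const 1)), zero_sub]

theorem integral_Iic_drift (ha : 0 < a) (b x : ℝ) :
    ∫ y in Set.Iic x, kinkDrift a b y * kinkWeight a b y = kinkWeight a b x := by
  rw [integral_Iic_of_hasDerivAt_of_tendsto' (fun y _ => hasDerivAt_kinkWeight a b y)
    (integrable_mul_kinkWeight ha b (LinGrowth.kinkDrift a b)).integrableOn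
    (by simpa using tendsto_mul_kinkWeight_atBot ha b (LinGrowth.const 1)), sub_zero]

theorem integral_Iic_add_Ioi_kinkWeight (ha : 0 < a) (b x : ℝ) (hf : LinGrowth f) :
    (∫ y in Set.Iic x, f y * kinkWeight a b y) + ∫ y in Set.Ioi x, f y * kinkWeight a b y =
      ∫ y, f y * kinkWeight a b y :=
  have h := integrable_mul_kinkWeight ha b hf
  intervalIntegral.integral_Iic_add_Ioi h.integrableOn h.integrableOn

theorem integral_drift (ha : 0 < a) (b : ℝ) : ∫ y, kinkDrift a b y * kinkWeight a b y = 0 := by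
  rw [← integral_Iic_add_Ioi_kinkWeight ha b 0 (LinGrowth.kinkDrift a b), integral_Ioi_drift ha,
    integral_Iic_drift ha, add_neg_cancel]

/-- Integration by parts with w' = D w; the boundary terms vanish at x and at infinity. -/
theorem integral_Ioi_sub_mul_drift (ha : 0 < a) (b x : ℝ) :
    ∫ y in Set.Ioi x, (y - x) * kinkDrift a b y * kinkWeight a b y =
      -∫ y in Set.Ioi x, kinkWeight a b y := by
  have hl : LinGrowth fun y => y - x := LinGrowth.id.sub (LinGrowth.const x)
  have hi := integrable_mul_mul_kinkWeight ha b hl (LinGrowth.kinkDrift a b)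
  have h := integral_Ioi_of_hasDerivAt_of_tendsto' (a := x)
    (f := fun y => (y - x) * kinkWeight a b y)
    (f' := fun y => kinkWeight a b y + (y - x) * kinkDrift a b y * kinkWeight a b y)
    (fun y _ => by
      refine (((hasDerivAt_id y).sub_const x).mul (hasDerivAt_kinkWeight a b y)).congr_deriv ?_
      simp only [id]
      ring)
    ((integrable_kinkWeight ha b).add hi).integrableOn
    (tendsto_mul_kinkWeight_atTop ha b hl)
  rw [integral_add (integrable_kinkWeight ha b).integrableOn hi.integrableOn] at h
  simp only [sub_self, zero_mul] at h
  linarith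

theorem integral_kinkWeight_pos (ha : 0 < a) (b : ℝ) : 0 < ∫ y, kinkWeight a b y := by
  rw [integral_pos_iff_support_of_nonneg (fun y => (kinkWeight_pos a b y).le)
    (integrable_kinkWeight ha b)]
  have : Function.support (kinkWeight a b) = Set.univ :=
    Set.eq_univ_of_forall fun y => (kinkWeight_pos a b y).ne'
  simp [this]

/-- Expectation with respect to the normalized weight. -/
def kinkMean (a b : ℝ) (f : ℝ → ℝ) : ℝ := (∫ y, f y * kinkWeight a b y) / ∫ y, kinkWeight a b y

theorem integral_sub_kinkMean (ha : 0 < a) (b : ℝ) (hf : LinGrowth f) :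
    ∫ y, (f y - kinkMean a b f) * kinkWeight a b y = 0 := by
  simp_rw [sub_mul]
  rw [integral_sub (integrable_mul_kinkWeight ha b hf) ((integrable_kinkWeight ha b).const_mul _),
    integral_const_mul, kinkMean]
  have := (integral_kinkWeight_pos ha b).ne'
  field_simp
  simp

/-- If f x ≥ 0 the integrand is nonnegative on the tail; otherwise it is nonpositive left of x, and
the zero total gives the sign on the right. All bounds on the Stein solution come from this
comparison. -/
theorem integral_Ioi_nonneg_of_monotone (ha : 0 < a) (b x : ℝ) (hf : LinGrowth f)
    (hm : Monotone f) (h0 : ∫ y, f y * kinkWeight a b y = 0) :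
    0 ≤ ∫ y in Set.Ioi x, f y * kinkWeight a b y := by
  rcases le_total 0 (f x) with h | h
  · refine setIntegral_nonneg measurableSet_Ioi fun y hy => ?_
    exact mul_nonneg (h.trans (hm (le_of_lt hy))) (kinkWeight_pos a b y).le
  · have h1 := integral_Iic_add_Ioi_kinkWeight ha b x hf
    have h2 : ∫ y in Set.Iic x, f y * kinkWeight a b y ≤ 0 :=
      setIntegral_nonpos measurableSet_Iic fun y hy =>
        mul_nonpos_of_nonpos_of_nonneg ((hm hy).trans h) (kinkWeight_pos a b y).le
    linarith

end Integrals

/-! ### Pointwise bounds on the Stein solution -/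

/-- The solution of the Stein equation `g' + kinkDrift a b * g = E h - h`. -/
def steinSol (a b : ℝ) (h : ℝ → ℝ) (x : ℝ) : ℝ :=
  (∫ y in Set.Ioi x, (h y - kinkMean a b h) * kinkWeight a b y) / kinkWeight a b x

section Stein

variable {a b : ℝ} {h : ℝ → ℝ}

theorem hasDerivAt_steinSol (ha : 0 < a) (hh : LinGrowth h) (x : ℝ) :
    HasDerivAt (steinSol a b h)
      (kinkMean a b h - h x - kinkDrift a b x * steinSol a b h x) x := by
  set φ : ℝ → ℝ := fun y => (h y - kinkMean a b h) * kinkWeight a b y with hφ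
  have hl : LinGrowth fun y => h y - kinkMean a b h := hh.sub (LinGrowth.const _)
  have hi : Integrable φ := integrable_mul_kinkWeight ha b hl
  have hc : Continuous φ := hl.1.mul (continuous_kinkWeight a b)
  have e : (fun x => ∫ y in Set.Ioi x, φ y) = fun x => (∫ y in Set.Ioi 0, φ y) - ∫ y in 0..x, φ y := by
    ext x
    rw [← intervalIntegral.integral_interval_add_Ioi (a := 0) (b := x) hi.integrableOn hi.integrableOn]
    ring
  have h1 : HasDerivAt (fun x => ∫ y in Set.Ioi x, φ y) (-φ x) x := by
    rw [e]
    exact (hc.integral_hasStrictDerivAt 0 x).hasDerivAt.const_sub _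
  have := (kinkWeight_pos a b x).ne'
  refine (h1.div (hasDerivAt_kinkWeight a b x) this).congr_deriv ?_
  simp only [steinSol, hφ]
  field_simp
  ring

/-- The hypotheses say that the increments of ψ dominate those of ±h, so ψ ± (h - E h) are monotone
with mean zero and `integral_Ioi_nonneg_of_monotone` applies to both. -/
theorem abs_steinSol_mul_le (ha : 0 < a) (hh : LinGrowth h) {ψ : ℝ → ℝ} (hψ : LinGrowth ψ)
    (h0 : ∫ y, ψ y * kinkWeight a b y = 0) (h1 : Monotone fun y => ψ y - h y)
    (h2 : Monotone fun y => ψ y + h y) (x : ℝ) :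
    |steinSol a b h x| * kinkWeight a b x ≤ ∫ y in Set.Ioi x, ψ y * kinkWeight a b y := by
  have hw := kinkWeight_pos a b x
  have hl : LinGrowth fun y => h y - kinkMean a b h := hh.sub (LinGrowth.const _)
  have iψ := integrable_mul_kinkWeight ha b hψ
  have ih := integrable_mul_kinkWeight ha b hl
  have hz := integral_sub_kinkMean ha b hh
  have e : |steinSol a b h x| * kinkWeight a b x =
      |∫ y in Set.Ioi x, (h y - kinkMean a b h) * kinkWeight a b y| := by
    rw [steinSol, abs_div, abs_of_pos hw, div_mul_cancel₀ _ hw.ne']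
  rw [e, abs_le]
  constructor
  · have h3 := integral_Ioi_nonneg_of_monotone ha b x (f := fun y => ψ y + (h y - kinkMean a b h))
      (hψ.add hl) (fun y z hyz => by have := h2 hyz; dsimp only at this ⊢; linarith) (by
        simp_rw [add_mul]; rw [integral_add iψ ih, h0, hz, add_zero])
    simp_rw [add_mul] at h3
    rw [integral_add iψ.integrableOn ih.integrableOn] at h3
    linarith
  · have h3 := integral_Ioi_nonneg_of_monotone ha b x (f := fun y => ψ y - (h y - kinkMean a b h))
      (hψ.sub hl) (fun y z hyz => by have := h1 hyz; dsimp only at this ⊢; linarith) (by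
        simp_rw [sub_mul (ψ _)]; rw [integral_sub iψ ih, h0, hz, sub_zero])
    simp_rw [sub_mul (ψ _)] at h3
    rw [integral_sub iψ.integrableOn ih.integrableOn] at h3
    linarith

theorem kinkDrift_sub_le {c : ℝ} (hca : c ≤ a) (hc1 : c ≤ 1) {x y : ℝ} (hxy : x ≤ y) :
    c * (y - x) ≤ kinkDrift a b x - kinkDrift a b y := by
  unfold kinkDrift
  have h1 : max (-x) 0 = max x 0 - x := by
    rcases le_total x 0 with h | h
    · rw [max_eq_left (by linarith), max_eq_right h]; ring
    · rw [max_eq_right (by linarith), max_eq_left h]; ring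
  have h2 : max (-y) 0 = max y 0 - y := by
    rcases le_total y 0 with h | h
    · rw [max_eq_left (by linarith), max_eq_right h]; ring
    · rw [max_eq_right (by linarith), max_eq_left h]; ring
  have h3 : max x 0 ≤ max y 0 := max_le_max hxy le_rfl
  have h4 : max (-y) 0 ≤ max (-x) 0 := max_le_max (by linarith) le_rfl
  rw [h1, h2] at h4 ⊢
  nlinarith

/-- Compare with ψ = -D/c: its slope is at least 1, and its tail integral is exactly w(x)/c. -/
theorem abs_steinSol_le (ha : 0 < a) (hh : ∀ x y, |h x - h y| ≤ |x - y|) {c : ℝ} (hc : 0 < c)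
    (hca : c ≤ a) (hc1 : c ≤ 1) (x : ℝ) : c * |steinSol a b h x| ≤ 1 := by
  have hw := kinkWeight_pos a b x
  have key : ∀ y z, y ≤ z → z - y ≤ -c⁻¹ * kinkDrift a b z - -c⁻¹ * kinkDrift a b y := by
    intro y z hyz
    have := mul_le_mul_of_nonneg_left (kinkDrift_sub_le (b := b) hca hc1 hyz) (inv_nonneg.2 hc.le)
    rw [inv_mul_cancel_left₀ hc.ne'] at this
    linarith
  have h1 := abs_steinSol_mul_le (b := b) ha (LinGrowth.of_lipschitz hh)
    (ψ := fun y => -c⁻¹ * kinkDrift a b y) ((LinGrowth.kinkDrift a b).const_mul _)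
    (by simp_rw [mul_assoc]; rw [integral_const_mul, integral_drift ha, mul_zero])
    (fun y z hyz => by
      have h1 := key y z hyz
      have h2 := (le_abs_self _).trans (hh z y)
      rw [abs_of_nonneg (sub_nonneg.2 hyz)] at h2
      dsimp only; linarith)
    (fun y z hyz => by
      have h1 := key y z hyz
      have h2 := (neg_abs_le _).trans' (neg_le_neg (hh z y))
      rw [abs_of_nonneg (sub_nonneg.2 hyz)] at h2
      dsimp only; linarith) x
  simp_rw [mul_assoc] at h1
  rw [integral_const_mul, integral_Ioi_drift ha, neg_mul_neg] at h1
  have h2 := le_of_mul_le_mul_right h1 hw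
  calc c * |steinSol a b h x| ≤ c * c⁻¹ := mul_le_mul_of_nonneg_left h2 hc.le
    _ = 1 := mul_inv_cancel₀ hc.ne'

theorem abs_steinSol_mul_le_id (ha : 0 < a) (hh : ∀ x y, |h x - h y| ≤ |x - y|) (x : ℝ) :
    |steinSol a b h x| * kinkWeight a b x ≤
      ∫ y in Set.Ioi x, (y - kinkMean a b fun y => y) * kinkWeight a b y :=
  abs_steinSol_mul_le ha (LinGrowth.of_lipschitz hh)
    (LinGrowth.id.sub (LinGrowth.const _)) (integral_sub_kinkMean ha b LinGrowth.id)
    (fun y z hyz => by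
      have h2 := (le_abs_self _).trans (hh z y)
      rw [abs_of_nonneg (sub_nonneg.2 hyz)] at h2
      dsimp only; linarith)
    (fun y z hyz => by
      have h2 := (neg_abs_le _).trans' (neg_le_neg (hh z y))
      rw [abs_of_nonneg (sub_nonneg.2 hyz)] at h2
      dsimp only; linarith) x

/-- The mean of the positive part under the normalized weight. -/
def kinkPosMean (a b : ℝ) : ℝ := kinkMean a b fun y => max y 0

theorem kinkPosMean_nonneg (ha : 0 < a) : 0 ≤ kinkPosMean a b :=
  div_nonneg (integral_nonneg fun y => mul_nonneg (le_max_right _ _) (kinkWeight_pos a b y).le)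
    (integral_kinkWeight_pos ha b).le

theorem kinkPosMean_mul (ha : 0 < a) : kinkPosMean a b * ∫ y, kinkWeight a b y =
    ∫ y in Set.Ioi 0, y * kinkWeight a b y := by
  rw [kinkPosMean, kinkMean, div_mul_cancel₀ _ (integral_kinkWeight_pos ha b).ne',
    ← setIntegral_eq_integral_of_forall_compl_eq_zero (s := Set.Ioi 0)]
  · refine setIntegral_congr_fun measurableSet_Ioi fun y hy => ?_
    rw [max_eq_left (le_of_lt hy)]
  · intro y hy
    rw [max_eq_right (not_lt.1 hy), zero_mul]

/-- Take the mean of D = b - y + (1 - a) y⁺, which is zero. -/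
theorem kinkMean_id (ha : 0 < a) :
    (kinkMean a b fun y => y) = b + (1 - a) * kinkPosMean a b := by
  have hZ := integral_kinkWeight_pos ha b
  have e : ∀ y, kinkDrift a b y * kinkWeight a b y =
      b * kinkWeight a b y - y * kinkWeight a b y + (1 - a) * (max y 0 * kinkWeight a b y) := by
    intro y
    have h1 : max (-y) 0 = max y 0 - y := by
      rcases le_total y 0 with h | h
      · rw [max_eq_left (by linarith), max_eq_right h]; ring
      · rw [max_eq_right (by linarith), max_eq_left h]; ring
    rw [kinkDrift, h1]; ring
  have i0 := (integrable_kinkWeight ha b).const_mul b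
  have i1 := integrable_mul_kinkWeight ha b LinGrowth.id
  have i2 := (integrable_mul_kinkWeight ha b LinGrowth.id.max_zero).const_mul (1 - a)
  have h := integral_drift ha b
  simp_rw [e] at h
  rw [integral_add (f := fun y => b * kinkWeight a b y - y * kinkWeight a b y) (i0.sub i1) i2,
    integral_sub i0 i1, integral_const_mul, integral_const_mul] at h
  rw [kinkPosMean, kinkMean, kinkMean]
  field_simp
  linarith

/-- Integrating y D w over y > 0 by parts gives a E (V⁺)² - b E V⁺ = P(V > 0) ≤ 1; then (E V⁺)² ≤ E
(V⁺)². -/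
theorem kinkPosMean_sq_le (ha : 0 < a) : a * kinkPosMean a b ^ 2 - b * kinkPosMean a b ≤ 1 := by
  set e := kinkPosMean a b with he
  set Z := ∫ y, kinkWeight a b y with hZdef
  have hZ : 0 < Z := integral_kinkWeight_pos ha b
  have h1 : e * Z = ∫ y in Set.Ioi 0, y * kinkWeight a b y := kinkPosMean_mul ha
  have iw := (integrable_kinkWeight ha b).integrableOn (s := Set.Ioi 0)
  have i1 := (integrable_mul_kinkWeight ha b LinGrowth.id).integrableOn (s := Set.Ioi 0)
  have i2 := (integrable_mul_mul_kinkWeight ha b LinGrowth.id LinGrowth.id).integrableOn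
    (s := Set.Ioi 0)
  have h2 := integral_Ioi_sub_mul_drift ha b 0
  have h3 : ∫ y in Set.Ioi 0, (y - 0) * kinkDrift a b y * kinkWeight a b y =
      b * (∫ y in Set.Ioi 0, y * kinkWeight a b y) -
        a * ∫ y in Set.Ioi 0, y * y * kinkWeight a b y := by
    rw [← integral_const_mul, ← integral_const_mul, ← integral_sub (i1.const_mul b) (i2.const_mul a)]
    refine setIntegral_congr_fun measurableSet_Ioi fun y hy => ?_
    rw [kinkDrift_of_nonneg (le_of_lt hy)]
    ring
  have h4 : ∫ y in Set.Ioi 0, kinkWeight a b y ≤ Z :=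
    setIntegral_le_integral (integrable_kinkWeight ha b)
      (Filter.Eventually.of_forall fun y => (kinkWeight_pos a b y).le)
  have h5 : 0 ≤ (∫ y in Set.Ioi 0, y * y * kinkWeight a b y) -
      2 * e * (∫ y in Set.Ioi 0, y * kinkWeight a b y) + e ^ 2 * ∫ y in Set.Ioi 0, kinkWeight a b y := by
    rw [← integral_const_mul, ← integral_const_mul, ← integral_sub i2 (i1.const_mul _),
      ← integral_add (f := fun y => y * y * kinkWeight a b y - 2 * e * (y * kinkWeight a b y))
        (i2.sub (i1.const_mul _)) (iw.const_mul _)]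
    refine setIntegral_nonneg measurableSet_Ioi fun y _ => ?_
    have : 0 ≤ (y - e) ^ 2 * kinkWeight a b y := mul_nonneg (sq_nonneg _) (kinkWeight_pos a b y).le
    linarith
  rw [h3, ← h1] at h2
  rw [← h1] at h5
  have h6 := mul_le_mul_of_nonneg_left h4 (sq_nonneg e)
  have h7 : e ^ 2 * Z ≤ ∫ y in Set.Ioi 0, y * y * kinkWeight a b y := by nlinarith
  have h8 := mul_le_mul_of_nonneg_left h7 ha.le
  have : (a * e ^ 2 - b * e) * Z ≤ 1 * Z := by linarith
  exact le_of_mul_le_mul_right this hZ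

/-- For x ≤ 0 the comparison tail of y - m, m = E V, is minus its integral over (-∞, x]. There y - m
= (b - m) - D, the D part integrates to w(x), and m - b = (1 - a) E V⁺ ≤ E V⁺. -/
theorem abs_steinSol_mul_le_of_nonpos (ha : 0 < a)
    (hh : ∀ x y, |h x - h y| ≤ |x - y|) {x : ℝ} (hx : x ≤ 0) :
    |steinSol a b h x| * kinkWeight a b x ≤
      kinkWeight a b x + kinkPosMean a b * ∫ y in Set.Iic x, kinkWeight a b y := by
  refine (abs_steinSol_mul_le_id ha hh x).trans ?_
  set m := kinkMean a b fun y => y with hm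
  have hl : LinGrowth fun y => y - m := LinGrowth.id.sub (LinGrowth.const _)
  have h1 := integral_Iic_add_Ioi_kinkWeight ha b x hl
  rw [integral_sub_kinkMean ha b LinGrowth.id] at h1
  have h2 : ∫ y in Set.Iic x, (y - m) * kinkWeight a b y =
      (b - m) * (∫ y in Set.Iic x, kinkWeight a b y) -
        ∫ y in Set.Iic x, kinkDrift a b y * kinkWeight a b y := by
    rw [← integral_const_mul, ← integral_sub ((integrable_kinkWeight ha b).integrableOn.const_mul _)
      (integrable_mul_kinkWeight ha b (LinGrowth.kinkDrift a b)).integrableOn]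
    refine setIntegral_congr_fun measurableSet_Iic fun y hy => ?_
    rw [kinkDrift_of_nonpos (le_trans hy hx)]
    ring
  rw [integral_Iic_drift ha] at h2
  have h3 : m = b + (1 - a) * kinkPosMean a b := kinkMean_id ha
  have h4 : 0 ≤ ∫ y in Set.Iic x, kinkWeight a b y :=
    setIntegral_nonneg measurableSet_Iic fun y _ => (kinkWeight_pos a b y).le
  have h5 : (m - b) * (∫ y in Set.Iic x, kinkWeight a b y) ≤
      kinkPosMean a b * ∫ y in Set.Iic x, kinkWeight a b y := by
    refine mul_le_mul_of_nonneg_right ?_ h4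
    nlinarith [kinkPosMean_nonneg (b := b) ha]
  linarith

theorem integral_Iic_kinkWeight_le (ha : 0 < a) (hb : -1 ≤ b) {x : ℝ} (hx : x ≤ 0) :
    ∫ y in Set.Iic x, kinkWeight a b y ≤ Real.exp 2 * kinkWeight a b x := by
  -- With s = x - y, the exponents compare because 2s - s²/2 ≤ 2. The exponential on the right is
  -- integrable in closed form.
  have h1 : ∀ y ∈ Set.Iic x, kinkWeight a b y ≤
      Real.exp (2 - x) * kinkWeight a b x * Real.exp y := by
    intro y hy
    have hy' : y ≤ x := hy
    rw [kinkWeight_of_nonpos hx, kinkWeight_of_nonpos (hy'.trans hx), ← Real.exp_add,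
      ← Real.exp_add]
    refine Real.exp_le_exp.2 ?_
    nlinarith [sq_nonneg (x - y - 2), mul_nonneg (sub_nonneg.2 hy') (by linarith : 0 ≤ b + 1),
      mul_nonneg (sub_nonneg.2 hy') (neg_nonneg.2 hx)]
  refine (setIntegral_mono_on (integrable_kinkWeight ha b).integrableOn
    ((integrableOn_exp_Iic x).const_mul _) measurableSet_Iic h1).trans_eq ?_
  rw [integral_const_mul, integral_exp_Iic, mul_right_comm, ← Real.exp_add, sub_add_cancel]

/-- Left of the kink w(y) ≤ w(y - x) w(x), because x (y - x) ≥ 0. The total mass on the right later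
turns E V⁺ into ∫ y w over y > 0. -/
theorem integral_Iic_kinkWeight_le_mul (ha : 0 < a) {x : ℝ} (hx : x ≤ 0) :
    ∫ y in Set.Iic x, kinkWeight a b y ≤ (∫ y, kinkWeight a b y) * kinkWeight a b x := by
  have iw := integrable_kinkWeight ha b
  have h1 : ∀ y ∈ Set.Iic x, kinkWeight a b y ≤ kinkWeight a b (y - x) * kinkWeight a b x := by
    intro y hy
    have hy' : y ≤ x := hy
    rw [kinkWeight_of_nonpos hx, kinkWeight_of_nonpos (hy'.trans hx),
      kinkWeight_of_nonpos (sub_nonpos.2 hy'), ← Real.exp_add]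
    refine Real.exp_le_exp.2 ?_
    nlinarith [mul_nonneg (sub_nonneg.2 hy') (neg_nonneg.2 hx)]
  refine (setIntegral_mono_on iw.integrableOn ((iw.comp_sub_right x).mul_const _).integrableOn
    measurableSet_Iic h1).trans ?_
  refine (setIntegral_le_integral ((iw.comp_sub_right x).mul_const _)
    (Filter.Eventually.of_forall fun y =>
      (mul_pos (kinkWeight_pos a b _) (kinkWeight_pos a b x)).le)).trans_eq ?_
  rw [integral_mul_const, integral_sub_right_eq_self (kinkWeight a b)]

theorem abs_steinSol_le_of_nonpos (ha : 0 < a) (hb : -1 ≤ b)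
    (hh : ∀ x y, |h x - h y| ≤ |x - y|) {x : ℝ} (hx : x ≤ 0) :
    |steinSol a b h x| ≤ 1 + Real.exp 2 * kinkPosMean a b := by
  have hw := kinkWeight_pos a b x
  have h1 := abs_steinSol_mul_le_of_nonpos (b := b) ha hh hx
  have h2 := mul_le_mul_of_nonneg_left (integral_Iic_kinkWeight_le ha hb hx)
    (kinkPosMean_nonneg (b := b) ha)
  refine le_of_mul_le_mul_right (h1.trans ?_) hw
  linarith

/-- Tail moments of the weight to the right of a point of nonpositive drift. -/
theorem neg_drift_mul_integral_Ioi_le (ha : 0 < a) (x : ℝ) :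
    -kinkDrift a b x * (∫ y in Set.Ioi x, kinkWeight a b y) ≤ kinkWeight a b x := by
  rw [← neg_neg (kinkWeight a b x), ← integral_Ioi_drift ha b x, ← integral_const_mul, ← integral_neg]
  refine setIntegral_mono_on ((integrable_kinkWeight ha b).integrableOn.const_mul _)
    (integrable_mul_kinkWeight ha b (LinGrowth.kinkDrift a b)).integrableOn.neg measurableSet_Ioi
    fun y hy => ?_
  have := mul_le_mul_of_nonneg_right (kinkDrift_antitone (b := b) ha.le (le_of_lt hy))
    (kinkWeight_pos a b y).le
  linarith

theorem neg_drift_mul_integral_Ioi_sub_le (ha : 0 < a) (x : ℝ) :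
    -kinkDrift a b x * (∫ y in Set.Ioi x, (y - x) * kinkWeight a b y) ≤
      ∫ y in Set.Ioi x, kinkWeight a b y := by
  have hl : LinGrowth fun y => y - x := LinGrowth.id.sub (LinGrowth.const x)
  rw [← neg_neg (∫ y in Set.Ioi x, kinkWeight a b y), ← integral_Ioi_sub_mul_drift ha b x,
    ← integral_const_mul, ← integral_neg]
  refine setIntegral_mono_on ((integrable_mul_kinkWeight ha b hl).integrableOn.const_mul _)
    (integrable_mul_mul_kinkWeight ha b hl (LinGrowth.kinkDrift a b)).integrableOn.neg
    measurableSet_Ioi fun y hy => ?_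
  have hy' : x < y := hy
  have := mul_le_mul_of_nonneg_right (kinkDrift_antitone (b := b) ha.le hy'.le)
    (mul_nonneg (sub_pos.2 hy').le (kinkWeight_pos a b y).le)
  linarith

/-- A drift of at most -1 on the right gives ∫ w ≤ 1 and then ∫ y w ≤ 1 over y > 0; the second
bounds E V⁺ times the total mass. -/
theorem abs_steinSol_le_two (ha : 0 < a) (hb : b ≤ -1)
    (hh : ∀ x y, |h x - h y| ≤ |x - y|) {x : ℝ} (hx : x ≤ 0) :
    |steinSol a b h x| ≤ 2 := by
  have hw := kinkWeight_pos a b x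
  have h1 := abs_steinSol_mul_le_of_nonpos (b := b) ha hh hx
  have h2 := mul_le_mul_of_nonneg_left (integral_Iic_kinkWeight_le_mul (b := b) ha hx)
    (kinkPosMean_nonneg (b := b) ha)
  rw [← mul_assoc, kinkPosMean_mul ha] at h2
  have h3 := neg_drift_mul_integral_Ioi_le (b := b) ha 0
  have h4 := neg_drift_mul_integral_Ioi_sub_le (b := b) ha 0
  rw [kinkDrift_of_nonneg le_rfl, mul_zero, sub_zero] at h3 h4
  simp only [sub_zero] at h4
  rw [kinkWeight_zero] at h3
  have h5 : 0 ≤ ∫ y in Set.Ioi 0, kinkWeight a b y :=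
    setIntegral_nonneg measurableSet_Ioi fun y _ => (kinkWeight_pos a b y).le
  have h6 : 0 ≤ ∫ y in Set.Ioi 0, y * kinkWeight a b y :=
    setIntegral_nonneg measurableSet_Ioi fun y hy =>
      mul_nonneg (le_of_lt hy) (kinkWeight_pos a b y).le
  have h7 : ∫ y in Set.Ioi 0, y * kinkWeight a b y ≤ 1 := by nlinarith
  have h8 := mul_le_mul_of_nonneg_right h7 hw.le
  refine le_of_mul_le_mul_right (h1.trans ?_) hw
  linarith

/-- Since E V ≥ b, the comparison tail is at most ∫ (y - x) w + (x - b) ∫ w. Each factor -D(x)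
removes one integration, by the two preceding tail bounds. Unlike the bound 1/a, the result does not
blow up as a → 0. -/
theorem sq_drift_mul_abs_steinSol_le (ha : 0 < a) (ha1 : a ≤ 1) (hb : b ≤ 0)
    (hh : ∀ x y, |h x - h y| ≤ |x - y|) {x : ℝ} (hx : 0 ≤ x) :
    kinkDrift a b x ^ 2 * |steinSol a b h x| ≤ -kinkDrift a b x * (x - b) + 1 := by
  have hw := kinkWeight_pos a b x
  set v := -kinkDrift a b x with hv
  have hv0 : 0 ≤ v := by
    rw [hv, kinkDrift_of_nonneg hx]
    have := mul_nonneg ha.le hx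
    linarith
  have h1 := abs_steinSol_mul_le_id (b := b) ha hh x
  rw [kinkMean_id ha] at h1
  have hl : LinGrowth fun y => y - x := LinGrowth.id.sub (LinGrowth.const x)
  have il := (integrable_mul_kinkWeight ha b hl).integrableOn (s := Set.Ioi x)
  have iw := (integrable_kinkWeight ha b).integrableOn (s := Set.Ioi x)
  have h2 : ∫ y in Set.Ioi x, (y - (b + (1 - a) * kinkPosMean a b)) * kinkWeight a b y ≤
      (∫ y in Set.Ioi x, (y - x) * kinkWeight a b y) +
        (x - b) * ∫ y in Set.Ioi x, kinkWeight a b y := by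
    rw [← integral_const_mul, ← integral_add il (iw.const_mul _)]
    refine setIntegral_mono_on (integrable_mul_kinkWeight ha b
      (LinGrowth.id.sub (LinGrowth.const _))).integrableOn (il.add (iw.const_mul _))
      measurableSet_Ioi fun y _ => ?_
    have := mul_nonneg (mul_nonneg (sub_nonneg.2 ha1) (kinkPosMean_nonneg (b := b) ha))
      (kinkWeight_pos a b y).le
    linarith
  have h3 := neg_drift_mul_integral_Ioi_le (b := b) ha x
  have h4 := neg_drift_mul_integral_Ioi_sub_le (b := b) ha x
  rw [← hv] at h3 h4
  have h5 := mul_le_mul_of_nonneg_left (h1.trans h2) (sq_nonneg v)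
  have h6 := mul_le_mul_of_nonneg_left h4 hv0
  have h7 := mul_le_mul_of_nonneg_left h3 (mul_nonneg hv0 (by linarith : 0 ≤ x - b))
  have e : kinkDrift a b x ^ 2 = v ^ 2 := by rw [hv]; ring
  rw [e]
  refine le_of_mul_le_mul_right ?_ hw
  nlinarith

end Stein

/-! ### Chain moments on either side of the kink -/

namespace IsKinkChain

variable {a b δ : ℝ} {n : ℕ} {p : ℕ → ℝ}

theorem lattice_nonpos (H : IsKinkChain a b δ n p) {k : ℕ} (hk : k ≤ n) :
    δ * ((k : ℝ) - n) ≤ 0 := by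
  have : (k : ℝ) ≤ n := by exact_mod_cast hk
  nlinarith [H.delta_pos]

theorem lattice_ge (H : IsKinkChain a b δ n p) {k : ℕ} (hk : n < k) :
    δ ≤ δ * ((k : ℝ) - n) := by
  have : (n : ℝ) + 1 ≤ k := by exact_mod_cast hk
  nlinarith [H.delta_pos]

theorem mean_indicator_add (H : IsKinkChain a b δ n p) {f : ℕ → ℝ} (hf : PolyBdd 2 f) :
    mean p (fun k => if k ≤ n then f k else 0) + mean p (fun k => if n < k then f k else 0) =
      mean p f := by
  rw [← H.mean_add (hf.indicator _) (hf.indicator _)]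
  congr 1
  ext k
  rcases le_or_gt k n with h | h
  · simp [h, not_lt.2 h]
  · simp [h, not_le.2 h]

/-- The function b D - a D u⁺ equals D² for k > n and b D for k ≤ n, and its mean is a P(k ≥ n). -/
theorem mean_sq_right_add (H : IsKinkChain a b δ n p) :
    mean p (fun k => if n < k then latticeDrift a b δ n k ^ 2 else 0) +
      b * mean p (fun k => if k ≤ n then latticeDrift a b δ n k else 0) ≤ a := by
  have hD := PolyBdd.drift a b δ n
  have hD2 : PolyBdd 2 (latticeDrift a b δ n) := hD.mono one_le_two
  have hpos := (hD.mul (PolyBdd.lattice δ n).max_zero)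
  have e : mean p (fun k => b * latticeDrift a b δ n k -
      a * (latticeDrift a b δ n k * max (δ * ((k : ℝ) - n)) 0)) ≤ a := by
    rw [H.mean_sub (hD2.const_mul b) (hpos.const_mul a), mean_const_mul, mean_const_mul,
      H.mean_drift, H.mean_drift_mul_pos]
    nlinarith [H.mean_indicator_le_one (fun k => n ≤ k), H.a_pos]
  refine le_trans (le_of_eq ?_) e
  rw [← mean_const_mul, ← H.mean_add (hD.sq.indicator _) ((hD2.indicator _).const_mul _)]
  congr 1
  ext k
  rcases le_or_gt k n with h | h
  · rw [if_neg (not_lt.2 h), if_pos h, max_eq_right (H.lattice_nonpos h)]; ring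
  · rw [if_pos h, if_neg (not_le.2 h), max_eq_left (H.delta_pos.le.trans (H.lattice_ge h)),
      H.drift_of_ge h.le]
    ring

theorem mean_sq_right_le (H : IsKinkChain a b δ n p) :
    mean p (fun k => if n < k then latticeDrift a b δ n k ^ 2 else 0) ≤
      2 * a + max (-b) 0 ^ 2 := by
  have h1 := H.mean_sq_right_add
  have hD := PolyBdd.drift a b δ n
  have hD2 : PolyBdd 2 (latticeDrift a b δ n) := hD.mono one_le_two
  rcases le_total 0 b with hb | hb
  · have h2 : 0 ≤ mean p (fun k => if k ≤ n then latticeDrift a b δ n k else 0) :=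
      H.mean_nonneg fun k => by
        split_ifs with h
        · rw [H.drift_of_le h]; linarith [H.lattice_nonpos h]
        · exact le_rfl
    nlinarith [H.a_pos, sq_nonneg (max (-b) 0)]
  · rw [max_eq_left (by linarith)]
    have h2 := H.mean_indicator_add hD2
    rw [H.mean_drift] at h2
    -- Young's inequality; half of E[D²; k > n] is absorbed on the left.
    have h3 : b * mean p (fun k => if n < k then latticeDrift a b δ n k else 0) ≤
        b ^ 2 / 2 + 1 / 2 * mean p (fun k => if n < k then latticeDrift a b δ n k ^ 2 else 0) := by
      rw [← mean_const_mul, ← mean_const_mul, ← H.mean_const (b ^ 2 / 2),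
        ← H.mean_add (PolyBdd.const _) ((hD.sq.indicator _).const_mul _)]
      refine H.mean_mono ((hD2.indicator _).const_mul _)
        ((PolyBdd.const _).add ((hD.sq.indicator _).const_mul _)) fun k => ?_
      split_ifs
      · nlinarith [sq_nonneg (b - latticeDrift a b δ n k)]
      · nlinarith [sq_nonneg b]
    have h4 : mean p (fun k => if k ≤ n then latticeDrift a b δ n k else 0) =
      -mean p (fun k => if n < k then latticeDrift a b δ n k else 0) := by linarith
    rw [h4] at h1
    linarith

/-- E D⁺ = E D⁻. Left of the kink D⁻ ≤ b⁻; right of it D⁻ ≤ t/2 + D²/(2t) with t = b⁻ + √a, the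
scale for which E[D²; k > n] ≤ 2t². -/
theorem mean_drift_pos_le (H : IsKinkChain a b δ n p) :
    mean p (fun k => max (latticeDrift a b δ n k) 0) ≤ 5 / 2 * (max (-b) 0 + √a) := by
  have hD := PolyBdd.drift a b δ n
  have hD2 : PolyBdd 2 (latticeDrift a b δ n) := hD.mono one_le_two
  set z := max (-b) 0 with hz
  have hz0 : 0 ≤ z := le_max_right _ _
  have hs : 0 < √a := Real.sqrt_pos.2 H.a_pos
  have hs2 : √a ^ 2 = a := Real.sq_sqrt H.a_pos.le
  set t := z + √a with ht
  have ht0 : 0 < t := by positivity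
  have h1 := H.mean_sq_right_le
  rw [← hz] at h1
  have h2 : mean p (fun k => if n < k then latticeDrift a b δ n k ^ 2 else 0) ≤ 2 * t ^ 2 := by
    nlinarith [mul_nonneg hz0 hs.le]
  have h3 : mean p (fun k => max (latticeDrift a b δ n k) 0) =
      mean p (fun k => max (-latticeDrift a b δ n k) 0) := by
    rw [← sub_eq_zero, ← H.mean_sub hD2.max_zero hD2.neg.max_zero]
    refine Eq.trans ?_ H.mean_drift
    congr 1
    ext k
    rcases le_total (latticeDrift a b δ n k) 0 with h | h
    · rw [max_eq_right h, max_eq_left (by linarith)]; ring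
    · rw [max_eq_left h, max_eq_right (by linarith)]; ring
  rw [h3]
  have h4 : mean p (fun k => max (-latticeDrift a b δ n k) 0) ≤ mean p (fun k => (z + t / 2) +
      1 / (2 * t) * (if n < k then latticeDrift a b δ n k ^ 2 else 0)) := by
    refine H.mean_mono hD2.neg.max_zero
      ((PolyBdd.const _).add ((hD.sq.indicator _).const_mul _)) fun k => ?_
    split_ifs with h
    · have h5 : |latticeDrift a b δ n k| ≤ t / 2 + 1 / (2 * t) * latticeDrift a b δ n k ^ 2 := by
        have : t / 2 + 1 / (2 * t) * latticeDrift a b δ n k ^ 2 - |latticeDrift a b δ n k| =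
            (|latticeDrift a b δ n k| - t) ^ 2 / (2 * t) := by
          rw [← sq_abs]; field_simp; ring
        have := div_nonneg (sq_nonneg (|latticeDrift a b δ n k| - t)) (by positivity : 0 ≤ 2 * t)
        linarith
      refine max_le ?_ (by positivity)
      linarith [neg_abs_le (latticeDrift a b δ n k)]
    · have h5 := H.lattice_nonpos (not_lt.1 h)
      have h6 := le_max_left (-b) 0
      rw [H.drift_of_le (not_lt.1 h)]
      refine max_le ?_ (by positivity)
      linarith
  rw [H.mean_add (PolyBdd.const _) ((hD.sq.indicator _).const_mul _), H.mean_const,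
    mean_const_mul] at h4
  have h5 : 1 / (2 * t) * mean p (fun k => if n < k then latticeDrift a b δ n k ^ 2 else 0) ≤ t := by
    calc _ ≤ 1 / (2 * t) * (2 * t ^ 2) := mul_le_mul_of_nonneg_left h2 (by positivity)
      _ = t := by field_simp
  linarith

theorem mean_indicator_left_le (H : IsKinkChain a b δ n p) (hb : -1 ≤ b) :
    mean p (fun k => if k ≤ n then (1 : ℝ) else 0) ≤
      4 * mean p (fun k => if k ≤ n then max (latticeDrift a b δ n k) 0 else 0) := by
  have hδ := H.delta_pos
  have hD := PolyBdd.drift a b δ n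
  have hDp : PolyBdd 2 (fun k => if k ≤ n then max (latticeDrift a b δ n k) 0 else 0) :=
    (hD.mono one_le_two).max_zero.indicator _
  -- `G` falls at unit rate while u⁻ ≤ 2. Its jump of size 1 after k = n covers that state, since
  -- 1/δ ≥ 1. Where u⁻ ≥ 2, b ≥ -1 gives D ≥ 1. The bound `G` ≤ 3 and this last region together give
  -- the factor 4.
  set G : ℕ → ℝ := fun k => if k ≤ n then 1 + min (-(δ * ((k : ℝ) - n))) 2 else 0 with hG
  have hG0 : ∀ k, 0 ≤ G k := fun k => by
    simp only [hG]
    split_ifs with h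
    · have := H.lattice_nonpos h
      have : 0 ≤ min (-(δ * ((k : ℝ) - n))) 2 := le_min (by linarith) (by norm_num)
      linarith
    · exact le_rfl
  have hG3 : ∀ k, G k ≤ 3 := fun k => by
    simp only [hG]
    split_ifs with h
    · have := min_le_right (-(δ * ((k : ℝ) - n))) 2
      linarith
    · norm_num
  have bG : ∀ {m}, PolyBdd m G := fun {m} => (PolyBdd.const 3).of_abs_le fun k => by
    rw [abs_of_nonneg (hG0 k)]; norm_num [hG3 k]
  have h1 : mean p (fun k => latticeDrift a b δ n k * G k) ≤
      3 * mean p (fun k => if k ≤ n then max (latticeDrift a b δ n k) 0 else 0) := by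
    rw [← mean_const_mul]
    refine H.mean_mono (hD.mul (bG (m := 1))) (hDp.const_mul 3) fun k => ?_
    split_ifs with h
    · nlinarith [hG0 k, hG3 k, le_max_left (latticeDrift a b δ n k) 0,
        le_max_right (latticeDrift a b δ n k) 0,
        mul_le_mul_of_nonneg_right (le_max_left (latticeDrift a b δ n k) 0) (hG0 k)]
    · simp [hG, h]
  rw [H.mean_drift_mul bG, ← mean_neg] at h1
  have bΔ : PolyBdd 2 fun k => -((G (k + 1) - G k) / δ) := by
    have : PolyBdd 2 fun k => -(δ⁻¹ * (G (k + 1) - G k)) := ((bG.shift.sub bG).const_mul δ⁻¹).neg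
    simpa [div_eq_inv_mul] using this
  have h2 : mean p (fun k => if k ≤ n then (1 : ℝ) else 0) ≤
      mean p (fun k => -((G (k + 1) - G k) / δ)) +
      mean p (fun k => if k ≤ n then max (latticeDrift a b δ n k) 0 else 0) := by
    rw [← H.mean_add bΔ hDp]
    refine H.mean_mono (polyBdd_indicator _) (bΔ.add hDp) fun k => ?_
    have e : -((G (k + 1) - G k) / δ) = (G k - G (k + 1)) / δ := by ring
    rw [e]
    rcases lt_trichotomy k n with h | h | h
    · have h' : k + 1 ≤ n := h
      have h3 : ((k + 1 : ℕ) : ℝ) ≤ n := by exact_mod_cast h'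
      simp only [hG, if_pos h.le, if_pos h']
      push_cast at h3 ⊢
      have h4 : δ * ((k : ℝ) + 1 - n) = δ * ((k : ℝ) - n) + δ := by ring
      rw [h4]
      rcases le_total (-(δ * ((k : ℝ) - n))) 2 with h5 | h5
      · rw [min_eq_left h5, min_eq_left (by linarith)]
        have : (1 + -(δ * ((k : ℝ) - n)) - (1 + -(δ * ((k : ℝ) - n) + δ))) / δ = 1 := by
          field_simp; ring
        rw [this]
        linarith [le_max_right (latticeDrift a b δ n k) 0]
      · rw [min_eq_right h5]
        have h6 : 0 ≤ (1 + 2 - (1 + min (-(δ * ((k : ℝ) - n) + δ)) 2)) / δ :=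
          div_nonneg (by linarith [min_le_right (-(δ * ((k : ℝ) - n) + δ)) 2]) hδ.le
        have h7 : 1 ≤ max (latticeDrift a b δ n k) 0 := by
          refine le_trans ?_ (le_max_left _ _)
          rw [H.drift_of_le h.le]; linarith
        linarith
    · subst h
      simp only [hG, le_refl, if_true, sub_self, mul_zero, neg_zero, not_le.2 (Nat.lt_succ_self k),
        if_false]
      have : 1 ≤ 1 / δ := by rw [le_div_iff₀ hδ]; linarith [H.delta_le]
      norm_num at this ⊢
      linarith [le_max_right (latticeDrift a b δ k k) 0]
    · have h' : ¬ k + 1 ≤ n := by omega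
      simp [hG, not_le.2 h, h']
  linarith

theorem mean_drift_mul_neg_le (H : IsKinkChain a b δ n p) :
    mean p (fun k => latticeDrift a b δ n k * max (-(δ * ((k : ℝ) - n))) 0) ≤
      mean p (fun k => if k ≤ n then (1 : ℝ) else 0) := by
  rw [H.mean_drift_mul_neg]
  refine H.mean_mono (polyBdd_indicator _) (polyBdd_indicator _) fun k => ?_
  rcases lt_or_ge k n with h | h
  · simp [h, h.le]
  · rw [if_neg (not_lt.2 h)]
    split_ifs <;> norm_num

theorem mean_sq_left_le (H : IsKinkChain a b δ n p) :
    mean p (fun k => if k ≤ n then latticeDrift a b δ n k ^ 2 else 0) ≤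
      b * mean p (fun k => if k ≤ n then latticeDrift a b δ n k else 0) +
        mean p (fun k => if k ≤ n then (1 : ℝ) else 0) := by
  have hD := PolyBdd.drift a b δ n
  have hD2 : PolyBdd 2 (latticeDrift a b δ n) := hD.mono one_le_two
  have hneg := (hD.mul (PolyBdd.lattice δ n).neg.max_zero)
  refine le_trans (le_of_eq ?_) (add_le_add_right H.mean_drift_mul_neg_le _)
  rw [← mean_const_mul, ← H.mean_add ((hD2.indicator _).const_mul _) hneg]
  congr 1
  ext k
  split_ifs with h
  · have h1 := H.lattice_nonpos h
    rw [max_eq_left (by linarith), H.drift_of_le h]; ring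
  · have h1 := H.lattice_ge (not_le.1 h)
    have := H.delta_pos
    rw [max_eq_right (by linarith)]; ring

theorem mean_sq_left_le_of_nonpos (H : IsKinkChain a b δ n p) (hb : b ≤ 0) :
    mean p (fun k => if k ≤ n then latticeDrift a b δ n k ^ 2 else 0) ≤
      (b ^ 2 + 1) * mean p (fun k => if k ≤ n then (1 : ℝ) else 0) := by
  have hD := PolyBdd.drift a b δ n
  have hD2 : PolyBdd 2 (latticeDrift a b δ n) := hD.mono one_le_two
  refine H.mean_sq_left_le.trans ?_
  rw [add_mul, one_mul]
  refine add_le_add_left ?_ _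
  rw [← mean_const_mul, ← mean_const_mul]
  refine H.mean_mono ((hD2.indicator _).const_mul _) ((polyBdd_indicator _).const_mul _) fun k => ?_
  split_ifs with h
  · rw [H.drift_of_le h]
    nlinarith [mul_nonneg (neg_nonneg.2 hb) (neg_nonneg.2 (H.lattice_nonpos h))]
  · simp

theorem mean_abs_drift_le (H : IsKinkChain a b δ n p) :
    mean p (fun k => |latticeDrift a b δ n k|) ≤ (1 + max 1 a) / 2 := by
  have hD := PolyBdd.drift a b δ n
  have h1 : mean p (fun k => |latticeDrift a b δ n k|) ≤
      mean p (fun k => 1 / 2 + 1 / 2 * latticeDrift a b δ n k ^ 2) :=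
    H.mean_mono (hD.mono one_le_two).abs ((PolyBdd.const _).add (hD.sq.const_mul _)) fun k => by
      nlinarith [sq_nonneg (|latticeDrift a b δ n k| - 1), sq_abs (latticeDrift a b δ n k)]
  rw [H.mean_add (PolyBdd.const _) (hD.sq.const_mul _), H.mean_const, mean_const_mul] at h1
  linarith [H.mean_drift_sq]

/-- With e = E V⁺ and P = P(k ≤ n), P ≤ 10 (b⁻ + √a). For b ≤ 0 the inequality a e² - b e ≤ 1 bounds
both b⁻ e and √a e by 1. For b ≥ 0 it gives a e ≤ b + √a, and b P ≤ 4a by `mean_sq_right_add`. -/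
theorem mean_indicator_mul_kinkPosMean_le (H : IsKinkChain a b δ n p) (hb : -1 ≤ b) :
    mean p (fun k => if k ≤ n then (1 : ℝ) else 0) * kinkPosMean a b ≤ 20 := by
  have hD := PolyBdd.drift a b δ n
  have hD2 : PolyBdd 2 (latticeDrift a b δ n) := hD.mono one_le_two
  have ha := H.a_pos
  set P := mean p (fun k => if k ≤ n then (1 : ℝ) else 0) with hP
  set e := kinkPosMean a b with he
  have he0 : 0 ≤ e := kinkPosMean_nonneg ha
  have he1 : a * e ^ 2 - b * e ≤ 1 := kinkPosMean_sq_le ha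
  have hP0 : 0 ≤ P := H.mean_nonneg fun k => by split_ifs <;> norm_num
  have hs : 0 < √a := Real.sqrt_pos.2 ha
  have hs2 : √a ^ 2 = a := Real.sq_sqrt ha.le
  set s := √a with hsdef
  have h1 := H.mean_indicator_left_le hb
  have h2 : mean p (fun k => if k ≤ n then max (latticeDrift a b δ n k) 0 else 0) ≤
      5 / 2 * (max (-b) 0 + s) := by
    refine le_trans ?_ H.mean_drift_pos_le
    refine H.mean_mono (hD2.max_zero.indicator _) hD2.max_zero fun k => ?_
    split_ifs
    · exact le_rfl
    · exact le_max_right _ _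
  have h3 : P ≤ 10 * (max (-b) 0 + s) := by linarith
  rcases le_total 0 b with hb0 | hb0
  · rw [max_eq_right (by linarith), zero_add] at h3
    have h4 : mean p (fun k => if k ≤ n then max (latticeDrift a b δ n k) 0 else 0) =
        mean p (fun k => if k ≤ n then latticeDrift a b δ n k else 0) := by
      congr 1
      ext k
      split_ifs with h
      · rw [max_eq_left]
        rw [H.drift_of_le h]; linarith [H.lattice_nonpos h]
      · rfl
    rw [h4] at h1
    have h5 := H.mean_sq_right_add
    have h6 : 0 ≤ mean p (fun k => if n < k then latticeDrift a b δ n k ^ 2 else 0) :=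
      H.mean_nonneg fun k => by split_ifs <;> positivity
    have h7 : b * P ≤ 4 * a := by nlinarith
    have h8 : a * e ≤ b + s := by
      by_contra! hc
      have h9 : s < s * (s * e) := by nlinarith
      have h10 : 1 < s * e := by
        by_contra! h11
        nlinarith
      nlinarith
    have h9 : P * e * a ≤ 20 * a := by
      have := mul_le_mul_of_nonneg_left h8 hP0
      have h10 := mul_le_mul_of_nonneg_right h3 hs.le
      nlinarith
    exact le_of_mul_le_mul_right h9 ha
  · rw [max_eq_left (by linarith)] at h3
    have h4 : -b * e ≤ 1 := by nlinarith [mul_nonneg ha.le (sq_nonneg e)]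
    have h5 : s * e ≤ 1 := by
      have : (s * e) ^ 2 ≤ 1 := by
        rw [mul_pow, hs2]; nlinarith [mul_nonneg (neg_nonneg.2 hb0) he0]
      nlinarith [mul_nonneg hs.le he0]
    nlinarith [mul_le_mul_of_nonneg_right h3 he0]

/-- Uniform control of the Stein solution left of the kink, averaged over the chain. -/
theorem exists_left_bound (H : IsKinkChain a b δ n p) (ha1 : a ≤ 1) :
    ∃ τ : ℝ, 0 ≤ τ ∧ (∀ h : ℝ → ℝ, (∀ x y, |h x - h y| ≤ |x - y|) → ∀ x ≤ 0,
      |steinSol a b h x| ≤ τ) ∧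
      τ * mean p (fun k => if k ≤ n then 1 + latticeDrift a b δ n k ^ 2 else 0) ≤ 483 := by
  have hD := PolyBdd.drift a b δ n
  have ha := H.a_pos
  have e0 : mean p (fun k => if k ≤ n then 1 + latticeDrift a b δ n k ^ 2 else 0) =
      mean p (fun k => if k ≤ n then (1 : ℝ) else 0) +
        mean p (fun k => if k ≤ n then latticeDrift a b δ n k ^ 2 else 0) := by
    rw [← H.mean_add (polyBdd_indicator _) (hD.sq.indicator _)]
    congr 1
    ext k
    split_ifs <;> simp
  rw [e0]
  have hP1 := H.mean_indicator_le_one fun k => k ≤ n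
  have hP0 : 0 ≤ mean p (fun k => if k ≤ n then (1 : ℝ) else 0) :=
    H.mean_nonneg fun k => by split_ifs <;> norm_num
  rcases le_total b (-1) with hb | hb
  · refine ⟨2, by norm_num, fun h hh x hx => abs_steinSol_le_two ha hb hh hx, ?_⟩
    have h1 : mean p (fun k => if k ≤ n then latticeDrift a b δ n k ^ 2 else 0) ≤ 1 := by
      refine le_trans ?_ (H.mean_drift_sq.trans_eq (max_eq_left ha1))
      refine H.mean_mono (hD.sq.indicator _) hD.sq fun k => ?_
      split_ifs
      · exact le_rfl
      · positivity
    linarith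
  · have hPe := H.mean_indicator_mul_kinkPosMean_le hb
    set P := mean p (fun k => if k ≤ n then (1 : ℝ) else 0) with hP
    set e := kinkPosMean a b with he
    have he0 : 0 ≤ e := kinkPosMean_nonneg ha
    have hE : Real.exp 2 ≤ 8 := by
      have h1 := Real.exp_one_lt_d9
      have h2 : Real.exp 2 = Real.exp 1 * Real.exp 1 := by rw [← Real.exp_add]; norm_num
      rw [h2]
      nlinarith [Real.exp_pos 1]
    set τ := min (1 + Real.exp 2 * e) (1 / a) with hτ
    have hτ0 : 0 ≤ τ := le_min (by positivity) (by positivity)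
    refine ⟨τ, hτ0, fun h hh x hx => le_min (abs_steinSol_le_of_nonpos ha hb hh hx) ?_, ?_⟩
    · rw [le_div_iff₀ ha, mul_comm]
      exact abs_steinSol_le ha hh ha le_rfl ha1 x
    -- 161 = 1 + 8 · 20, from e² ≤ 8 and P · E V⁺ ≤ 20. The final 483 = 3 · 161 arises for -1 ≤ b ≤
    -- 0, where E[D²; k ≤ n] ≤ 2P.
    · have h1 : τ * P ≤ 161 := by
        have h2 := mul_le_mul_of_nonneg_right (min_le_left (1 + Real.exp 2 * e) (1 / a)) hP0
        rw [← hτ] at h2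
        have h3 := mul_le_mul_of_nonneg_right hE (mul_nonneg hP0 he0)
        nlinarith
      rcases le_total 0 b with hb0 | hb0
      · have h2 := H.mean_sq_left_le
        have h5 := H.mean_sq_right_add
        have h6 : 0 ≤ mean p (fun k => if n < k then latticeDrift a b δ n k ^ 2 else 0) :=
          H.mean_nonneg fun k => by split_ifs <;> positivity
        have h7 : mean p (fun k => if k ≤ n then latticeDrift a b δ n k ^ 2 else 0) ≤ a + P := by
          linarith
        have h8 : τ * a ≤ 1 := by
          have := min_le_right (1 + Real.exp 2 * e) (1 / a)
          rwa [← hτ, le_div_iff₀ ha] at this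
        have h9 := mul_le_mul_of_nonneg_left h7 hτ0
        linarith
      · have h2 := H.mean_sq_left_le_of_nonpos hb0
        have h3 : (b ^ 2 + 1) * P ≤ 2 * P :=
          mul_le_mul_of_nonneg_right (by nlinarith) hP0
        have h9 := mul_le_mul_of_nonneg_left (h2.trans h3) hτ0
        linarith

end IsKinkChain

/-! ### Cell errors and the Stein bound -/

theorem abs_kinkDrift_sub_le {a b c : ℝ} (ha : 0 ≤ a) (hca : a ≤ c) (hc1 : 1 ≤ c) (x y : ℝ) :
    |kinkDrift a b x - kinkDrift a b y| ≤ c * |x - y| := by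
  wlog hxy : x ≤ y generalizing x y
  · rw [abs_sub_comm, abs_sub_comm x]
    exact this y x (le_of_not_ge hxy)
  rw [abs_of_nonneg (sub_nonneg.2 (kinkDrift_antitone ha hxy)), abs_sub_comm,
    abs_of_nonneg (sub_nonneg.2 hxy)]
  rcases le_total x 0 with hx | hx
  · rcases le_total y 0 with hy | hy
    · rw [kinkDrift_of_nonpos hx, kinkDrift_of_nonpos hy]; nlinarith
    · rw [kinkDrift_of_nonpos hx, kinkDrift_of_nonneg hy]; nlinarith
  · rw [kinkDrift_of_nonneg hx, kinkDrift_of_nonneg (hx.trans hxy)]; nlinarith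

namespace IsKinkChain

variable {a b δ : ℝ} {n : ℕ} {p : ℕ → ℝ}

/-- The function `T` dominates, on each lattice cell, the first order error of the Stein equation. -/
def CellBound (a b δ : ℝ) (n : ℕ) (h : ℝ → ℝ) (T : ℕ → ℝ) : Prop :=
  ∀ k : ℕ, ∀ x ∈ Set.Icc (δ * ((k : ℝ) - n) - δ) (δ * ((k : ℝ) - n)),
    |steinSol a b h x| * (|kinkDrift a b x - latticeDrift a b δ n k| +
      δ * |latticeDrift a b δ n k * kinkDrift a b x|) ≤ δ * T k

theorem abs_kinkDrift_le (H : IsKinkChain a b δ n p) {c : ℝ} (hca : a ≤ c) (hc1 : 1 ≤ c)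
    (k : ℕ) {x : ℝ} (hx : x ∈ Set.Icc (δ * ((k : ℝ) - n) - δ) (δ * ((k : ℝ) - n))) :
    |kinkDrift a b x - latticeDrift a b δ n k| ≤ c * δ ∧
      |kinkDrift a b x| ≤ |latticeDrift a b δ n k| + c := by
  have h1 : |kinkDrift a b x - latticeDrift a b δ n k| ≤ c * δ := by
    refine (abs_kinkDrift_sub_le H.a_pos.le hca hc1 _ _).trans ?_
    refine mul_le_mul_of_nonneg_left ?_ (by linarith)
    rw [abs_sub_comm, abs_of_nonneg (sub_nonneg.2 hx.2)]
    linarith [hx.1]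
  refine ⟨h1, ?_⟩
  have h2 := abs_add_le (kinkDrift a b x - latticeDrift a b δ n k) (latticeDrift a b δ n k)
  rw [sub_add_cancel] at h2
  nlinarith [H.delta_le]

theorem exists_cellBound_of_one_le (H : IsKinkChain a b δ n p) (ha1 : 1 ≤ a) :
    ∃ T : ℕ → ℝ, PolyBdd 2 T ∧ mean p T ≤ 2 * a + a * (1 + a) / 2 ∧
      ∀ h : ℝ → ℝ, (∀ x y, |h x - h y| ≤ |x - y|) → CellBound a b δ n h T := by
  have hD := PolyBdd.drift a b δ n
  have hD1 : PolyBdd 2 (fun k => a * |latticeDrift a b δ n k|) := (hD.mono one_le_two).abs.const_mul a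
  refine ⟨fun k => (a + latticeDrift a b δ n k ^ 2) + a * |latticeDrift a b δ n k|,
    ((PolyBdd.const a).add hD.sq).add hD1, ?_, ?_⟩
  · rw [H.mean_add ((PolyBdd.const a).add hD.sq) hD1, H.mean_add (PolyBdd.const a) hD.sq,
      H.mean_const, mean_const_mul]
    have h1 := H.mean_drift_sq
    have h2 := H.mean_abs_drift_le
    rw [max_eq_right ha1] at h1 h2
    have := mul_le_mul_of_nonneg_left h2 H.a_pos.le
    linarith
  · intro h hh k x hx
    obtain ⟨h1, h2⟩ := H.abs_kinkDrift_le le_rfl ha1 k hx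
    have h3 := abs_steinSol_le (b := b) H.a_pos hh one_pos ha1 le_rfl x
    rw [one_mul] at h3
    have hδ := H.delta_pos
    rw [abs_mul]
    have h4 : |kinkDrift a b x - latticeDrift a b δ n k| +
        δ * (|latticeDrift a b δ n k| * |kinkDrift a b x|) ≤
        δ * (a + latticeDrift a b δ n k ^ 2 + a * |latticeDrift a b δ n k|) := by
      have h5 := mul_le_mul_of_nonneg_left h2 (abs_nonneg (latticeDrift a b δ n k))
      have h6 := mul_le_mul_of_nonneg_left h5 hδ.le
      rw [← sq_abs (latticeDrift a b δ n k)]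
      linarith
    calc _ ≤ 1 * _ := mul_le_mul_of_nonneg_right h3 (by positivity)
      _ ≤ _ := by rw [one_mul]; exact h4

/-- Here D has slope -a, so its variation over a cell cancels the 1/a in |g|. For the product term,
b ≥ 0 uses E[D²; k > n] ≤ a, while b ≤ 0 uses `sq_drift_mul_abs_steinSol_le` and |b| ≤ |D|. -/
theorem exists_right_bound (H : IsKinkChain a b δ n p) (ha1 : a ≤ 1) :
    ∃ T : ℕ → ℝ, PolyBdd 2 T ∧ mean p (fun k => if n < k then T k else 0) ≤ 5 ∧
      ∀ h : ℝ → ℝ, (∀ x y, |h x - h y| ≤ |x - y|) → ∀ k : ℕ, n < k →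
        ∀ x ∈ Set.Icc (δ * ((k : ℝ) - n) - δ) (δ * ((k : ℝ) - n)),
          |steinSol a b h x| * (|kinkDrift a b x - latticeDrift a b δ n k| +
            δ * |latticeDrift a b δ n k * kinkDrift a b x|) ≤ δ * T k := by
  have hD := PolyBdd.drift a b δ n
  have ha := H.a_pos
  have hδ := H.delta_pos
  have hδ1 := H.delta_le
  have bA : PolyBdd 2 (fun k => |latticeDrift a b δ n k|) := (hD.mono one_le_two).abs
  have hA := H.mean_abs_drift_le
  have hS := H.mean_drift_sq
  rw [max_eq_left ha1] at hA hS
  have slope : ∀ k : ℕ, n < k → ∀ x ∈ Set.Icc (δ * ((k : ℝ) - n) - δ) (δ * ((k : ℝ) - n)),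
      0 ≤ x ∧ kinkDrift a b x - latticeDrift a b δ n k = a * (δ * ((k : ℝ) - n) - x) ∧
      a * (δ * ((k : ℝ) - n) - x) ≤ a * δ ∧ 0 ≤ a * (δ * ((k : ℝ) - n) - x) := by
    intro k hk x hx
    have h1 := H.lattice_ge hk
    have hx0 : 0 ≤ x := by linarith [hx.1]
    refine ⟨hx0, ?_, mul_le_mul_of_nonneg_left (by linarith [hx.1]) ha.le,
      mul_nonneg ha.le (by linarith [hx.2])⟩
    rw [H.drift_of_ge hk.le, kinkDrift_of_nonneg hx0]; ring
  rcases le_total 0 b with hb | hb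
  · refine ⟨fun k => (1 + 1 / a * latticeDrift a b δ n k ^ 2) + |latticeDrift a b δ n k|,
      ((PolyBdd.const 1).add (hD.sq.const_mul _)).add bA, ?_, ?_⟩
    · have h1 := H.mean_sq_right_add
      have h2 : 0 ≤ mean p (fun k => if k ≤ n then latticeDrift a b δ n k else 0) :=
        H.mean_nonneg fun k => by
          split_ifs with h
          · rw [H.drift_of_le h]; linarith [H.lattice_nonpos h]
          · exact le_rfl
      have h3 : mean p (fun k => if n < k then latticeDrift a b δ n k ^ 2 else 0) ≤ a := by
        nlinarith
      have h4 : mean p (fun k => if n < k then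
          (1 + 1 / a * latticeDrift a b δ n k ^ 2) + |latticeDrift a b δ n k| else 0) ≤
          mean p (fun k => (1 + 1 / a * (if n < k then latticeDrift a b δ n k ^ 2 else 0)) +
            |latticeDrift a b δ n k|) := by
        refine H.mean_mono ((((PolyBdd.const 1).add (hD.sq.const_mul _)).add bA).indicator _)
          (((PolyBdd.const 1).add ((hD.sq.indicator _).const_mul _)).add bA) fun k => ?_
        split_ifs
        · exact le_rfl
        · positivity
      rw [H.mean_add ((PolyBdd.const 1).add ((hD.sq.indicator _).const_mul _)) bA,
        H.mean_add (PolyBdd.const 1) ((hD.sq.indicator _).const_mul _), H.mean_const,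
        mean_const_mul] at h4
      have h5 : 1 / a * mean p (fun k => if n < k then latticeDrift a b δ n k ^ 2 else 0) ≤ 1 := by
        calc _ ≤ 1 / a * a := mul_le_mul_of_nonneg_left h3 (by positivity)
          _ = 1 := by field_simp
      linarith
    · intro h hh k hk x hx
      obtain ⟨hx0, e, h1, h2⟩ := slope k hk x hx
      have h3 := abs_steinSol_le (b := b) ha hh ha le_rfl ha1 x
      set g := |steinSol a b h x| with hg
      have hg0 : 0 ≤ g := abs_nonneg _
      rw [abs_mul, e, abs_of_nonneg h2]
      have h4 : |kinkDrift a b x| ≤ |latticeDrift a b δ n k| + a := by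
        have := abs_add_le (kinkDrift a b x - latticeDrift a b δ n k) (latticeDrift a b δ n k)
        rw [sub_add_cancel, e, abs_of_nonneg h2] at this
        nlinarith
      have h5 : g ≤ 1 / a := by rw [le_div_iff₀ ha]; linarith
      set d := |latticeDrift a b δ n k| with hd
      have hd0 : 0 ≤ d := abs_nonneg _
      dsimp only
      rw [← sq_abs (latticeDrift a b δ n k), ← hd]
      have h6 : a * (δ * ((k : ℝ) - n) - x) + δ * (d * |kinkDrift a b x|) ≤
          δ * (a + d ^ 2 + a * d) := by
        have := mul_le_mul_of_nonneg_left (mul_le_mul_of_nonneg_left h4 hd0) hδ.le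
        linarith
      calc _ ≤ g * (δ * (a + d ^ 2 + a * d)) := mul_le_mul_of_nonneg_left h6 hg0
        _ ≤ 1 / a * (δ * (a + d ^ 2 + a * d)) := mul_le_mul_of_nonneg_right h5 (by positivity)
        _ = _ := by field_simp
  · have hpos := (hD.mul (PolyBdd.lattice δ n).max_zero).neg
    have bT : PolyBdd 2 fun k => 2 + |latticeDrift a b δ n k| * (δ * ((k : ℝ) - n) - b) +
        |latticeDrift a b δ n k| :=
      ((PolyBdd.const 2).add (hD.abs.mul ((PolyBdd.lattice δ n).sub (PolyBdd.const b)))).add bA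
    refine ⟨_, bT, ?_, ?_⟩
    · have h4 : mean p (fun k => if n < k then 2 + |latticeDrift a b δ n k| *
            (δ * ((k : ℝ) - n) - b) + |latticeDrift a b δ n k| else 0) ≤
          mean p (fun k => (2 + -(latticeDrift a b δ n k * max (δ * ((k : ℝ) - n)) 0)) +
            (latticeDrift a b δ n k ^ 2 + |latticeDrift a b δ n k|)) := by
        refine H.mean_mono (bT.indicator _)
          (((PolyBdd.const 2).add hpos).add (hD.sq.add bA)) fun k => ?_
        rcases le_or_gt k n with hk | hk
        · rw [if_neg (not_lt.2 hk), max_eq_right (H.lattice_nonpos hk)]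
          rw [mul_zero, neg_zero]
          positivity
        · rw [if_pos hk]
          have h1 := H.lattice_ge hk
          rw [max_eq_left (by linarith)]
          have h2 := mul_nonneg ha.le (hδ.le.trans h1)
          have h3 : latticeDrift a b δ n k ≤ b := by rw [H.drift_of_ge hk.le]; linarith
          rw [abs_of_nonpos (h3.trans hb)]
          nlinarith [mul_nonneg (neg_nonneg.2 (h3.trans hb)) (sub_nonneg.2 h3)]
      rw [H.mean_add ((PolyBdd.const 2).add hpos) (hD.sq.add bA),
        H.mean_add (PolyBdd.const 2) hpos, H.mean_add hD.sq bA, H.mean_const, mean_neg,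
        H.mean_drift_mul_pos] at h4
      have := H.mean_indicator_le_one fun k => n ≤ k
      linarith
    · intro h hh k hk x hx
      obtain ⟨hx0, e, h1, h2⟩ := slope k hk x hx
      have h3 := abs_steinSol_le (b := b) ha hh ha le_rfl ha1 x
      have h4 := sq_drift_mul_abs_steinSol_le ha ha1 hb hh hx0
      set g := |steinSol a b h x| with hg
      have hg0 : 0 ≤ g := abs_nonneg _
      have h5 : kinkDrift a b x ≤ 0 := by
        rw [kinkDrift_of_nonneg hx0]; linarith [mul_nonneg ha.le hx0]
      have h6 : latticeDrift a b δ n k ≤ kinkDrift a b x := by linarith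
      rw [abs_mul, e, abs_of_nonneg h2, abs_of_nonpos h5, abs_of_nonpos (h6.trans h5)]
      set v := -kinkDrift a b x with hv
      set d := -latticeDrift a b δ n k with hd
      have hv0 : 0 ≤ v := neg_nonneg.2 h5
      have hvd : v ≤ d := neg_le_neg h6
      have hdv : d ≤ v + a * δ := by linarith
      have e2 : kinkDrift a b x ^ 2 = v ^ 2 := by rw [hv]; ring
      rw [e2] at h4
      -- Replacing d by v + aδ costs a g δ v ≤ v, because a g ≤ 1 and δ ≤ 1.
      have h7 : g * (d * v) ≤ v * (x - b) + 1 + v := by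
        have i1 : g * (d * v) ≤ g * ((v + a * δ) * v) := by gcongr
        have i2 : a * g * (δ * v) ≤ 1 * (1 * v) := by gcongr
        nlinarith
      have h8 : v * (x - b) ≤ d * (δ * ((k : ℝ) - n) - b) :=
        mul_le_mul hvd (by linarith [hx.2]) (by linarith) (hv0.trans hvd)
      have h9 : g * (a * (δ * ((k : ℝ) - n) - x)) ≤ δ := by
        calc _ ≤ g * (a * δ) := mul_le_mul_of_nonneg_left h1 hg0
          _ = a * g * δ := by ring
          _ ≤ 1 * δ := mul_le_mul_of_nonneg_right h3 hδ.le
          _ = δ := one_mul δ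
      have h10 := mul_le_mul_of_nonneg_left (show g * (d * v) ≤
        d * (δ * ((k : ℝ) - n) - b) + 1 + d by linarith) hδ.le
      linarith

theorem exists_cellBound_of_le_one (H : IsKinkChain a b δ n p) (ha1 : a ≤ 1) :
    ∃ T : ℕ → ℝ, PolyBdd 2 T ∧ mean p T ≤ 971 ∧
      ∀ h : ℝ → ℝ, (∀ x y, |h x - h y| ≤ |x - y|) → CellBound a b δ n h T := by
  obtain ⟨τ, hτ0, hτ, hτm⟩ := H.exists_left_bound ha1
  obtain ⟨T, bT, hTm, hT⟩ := H.exists_right_bound ha1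
  have hD := PolyBdd.drift a b δ n
  have hδ := H.delta_pos
  have bL : PolyBdd 2 fun k => 2 * (τ * if k ≤ n then 1 + latticeDrift a b δ n k ^ 2 else 0) :=
    ((((PolyBdd.const 1).add hD.sq).indicator _).const_mul τ).const_mul 2
  have bR : PolyBdd 2 fun k => if n < k then T k else 0 := bT.indicator _
  refine ⟨_, bL.add bR, ?_, ?_⟩
  · rw [H.mean_add bL bR, mean_const_mul, mean_const_mul]
    linarith
  · intro h hh k x hx
    rcases le_or_gt k n with hk | hk
    · obtain ⟨h1, h2⟩ := H.abs_kinkDrift_le ha1 le_rfl k hx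
      have h3 := hτ h hh x (hx.2.trans (H.lattice_nonpos hk))
      dsimp only
      rw [if_pos hk, if_neg (not_lt.2 hk), add_zero, abs_mul]
      rw [one_mul] at h1
      rw [← sq_abs (latticeDrift a b δ n k)]
      set d := |latticeDrift a b δ n k| with hd
      have hd0 : 0 ≤ d := abs_nonneg _
      have h4 : |kinkDrift a b x - latticeDrift a b δ n k| + δ * (d * |kinkDrift a b x|) ≤
          δ * (2 * (1 + d ^ 2)) := by
        have h5 := mul_le_mul_of_nonneg_left (mul_le_mul_of_nonneg_left h2 hd0) hδ.le
        have h6 : δ * (1 + d * (d + 1)) ≤ δ * (2 * (1 + d ^ 2)) :=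
          mul_le_mul_of_nonneg_left (by nlinarith [sq_nonneg (d - 1)]) hδ.le
        linarith
      calc _ ≤ τ * (δ * (2 * (1 + d ^ 2))) :=
            mul_le_mul h3 h4 (by positivity) hτ0
        _ = _ := by ring
    · dsimp only
      rw [if_neg (not_le.2 hk), if_pos hk, mul_zero, mul_zero, zero_add]
      exact hT h hh k hk x hx

theorem cell_estimate (H : IsKinkChain a b δ n p) {h : ℝ → ℝ}
    (hh : ∀ x y, |h x - h y| ≤ |x - y|) {T : ℕ → ℝ} (hT : CellBound a b δ n h T) (k : ℕ) :
    |(1 - δ * latticeDrift a b δ n k) * steinSol a b h (δ * ((k : ℝ) - n) - δ) -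
      steinSol a b h (δ * ((k : ℝ) - n)) + δ * ((1 - δ / 2 * latticeDrift a b δ n k) *
        (kinkMean a b h - h (δ * ((k : ℝ) - n))))| ≤
      δ ^ 2 * (T k + 1 + |latticeDrift a b δ n k|) := by
  have hδ := H.delta_pos
  set D := latticeDrift a b δ n k with hD
  set u := δ * ((k : ℝ) - n) with hu
  set c := kinkMean a b h with hc
  set g := steinSol a b h with hg
  have hg' := hasDerivAt_steinSol (b := b) H.a_pos (LinGrowth.of_lipschitz hh)
  -- `Φ` interpolates across the cell: the quantity to estimate is Φ(1) - Φ(0). In Φ' the Stein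
  -- equation replaces g', and the second summand cancels c - h up to h(u - tδ) - h(u), which is at
  -- most δ.
  set Φ : ℝ → ℝ := fun t => (1 - t * (δ * D)) * g (u - t * δ) +
    (δ * t - δ ^ 2 * (t ^ 2 / 2) * D) * (c - h u) with hΦ
  set Φ' : ℝ → ℝ := fun t => δ * (g (u - t * δ) * ((kinkDrift a b (u - t * δ) - D) -
      t * δ * (D * kinkDrift a b (u - t * δ))) +
    (1 - t * δ * D) * (h (u - t * δ) - h u)) with hΦ'
  have hder : ∀ t, HasDerivAt Φ (Φ' t) t := by
    intro t
    have h1 : HasDerivAt (fun t : ℝ => u - t * δ) (-δ) t := by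
      simpa using ((hasDerivAt_id t).mul_const δ).const_sub u
    have h2 : HasDerivAt (fun t : ℝ => 1 - t * (δ * D)) (-(δ * D)) t := by
      simpa using ((hasDerivAt_id t).mul_const (δ * D)).const_sub 1
    have h3 := h2.mul ((hg' (u - t * δ)).comp t h1)
    have h4 : HasDerivAt (fun t : ℝ => δ * t - δ ^ 2 * (t ^ 2 / 2) * D) (δ - δ ^ 2 * t * D) t := by
      have h5 := (hasDerivAt_id t).const_mul δ
      have h6 := (((hasDerivAt_pow 2 t).div_const 2).const_mul (δ ^ 2)).mul_const D
      refine (h5.sub h6).congr_deriv ?_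
      simp
    refine (h3.add (h4.mul_const (c - h u))).congr_deriv ?_
    simp only [hΦ', Function.comp_apply]
    ring
  have hbound : ∀ t ∈ Set.Ico (0 : ℝ) 1, ‖Φ' t‖ ≤ δ ^ 2 * (T k + 1 + |D|) := by
    intro t ht
    have htδ : 0 ≤ t * δ := mul_nonneg ht.1 hδ.le
    have htδ1 : t * δ ≤ δ := by nlinarith [ht.2]
    have h1 := hT k (u - t * δ) ⟨by linarith, by linarith⟩
    rw [← hD, ← hg] at h1
    have h2 : |h (u - t * δ) - h u| ≤ δ := by
      refine (hh _ _).trans ?_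
      rw [sub_sub_cancel_left, abs_neg, abs_of_nonneg htδ]
      exact htδ1
    have h3 : |1 - t * δ * D| ≤ 1 + |D| := by
      refine (abs_sub _ _).trans ?_
      rw [abs_one, abs_mul, abs_of_nonneg htδ]
      have := mul_le_mul_of_nonneg_right (htδ1.trans H.delta_le) (abs_nonneg D)
      linarith
    have h4 : |(kinkDrift a b (u - t * δ) - D) - t * δ * (D * kinkDrift a b (u - t * δ))| ≤
        |kinkDrift a b (u - t * δ) - D| + δ * |D * kinkDrift a b (u - t * δ)| := by
      refine (abs_sub _ _).trans ?_
      rw [abs_mul (t * δ), abs_of_nonneg htδ]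
      have := mul_le_mul_of_nonneg_right htδ1 (abs_nonneg (D * kinkDrift a b (u - t * δ)))
      linarith
    rw [Real.norm_eq_abs, hΦ', abs_mul, abs_of_pos hδ]
    calc δ * |g (u - t * δ) * ((kinkDrift a b (u - t * δ) - D) -
          t * δ * (D * kinkDrift a b (u - t * δ))) + (1 - t * δ * D) * (h (u - t * δ) - h u)|
        ≤ δ * (δ * T k + (1 + |D|) * δ) := by
          refine mul_le_mul_of_nonneg_left ((abs_add_le _ _).trans ?_) hδ.le
          rw [abs_mul, abs_mul (1 - t * δ * D)]
          exact add_le_add ((mul_le_mul_of_nonneg_left h4 (abs_nonneg _)).trans h1)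
            (mul_le_mul h3 h2 (abs_nonneg _) (by positivity))
      _ = _ := by ring
  have key := norm_image_sub_le_of_norm_deriv_le_segment_01'
    (fun t _ => (hder t).hasDerivWithinAt) hbound
  rw [Real.norm_eq_abs] at key
  refine le_of_eq_of_le ?_ key
  simp only [hΦ]
  congr 1
  simp only [one_mul, zero_mul, sub_zero, mul_zero, mul_one]
  ring

theorem abs_mean_sub_kinkMean_le_of_cellBound (H : IsKinkChain a b δ n p) {h : ℝ → ℝ}
    (hh : ∀ x y, |h x - h y| ≤ |x - y|) {T : ℕ → ℝ} (bT : PolyBdd 2 T)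
    (hT : CellBound a b δ n h T) :
    |mean p (fun k => h (δ * ((k : ℝ) - n))) - kinkMean a b h| ≤
      δ * (mean p T + 2 + max 1 a / 2) := by
  have hδ := H.delta_pos
  have hD := PolyBdd.drift a b δ n
  have bA : PolyBdd 2 (fun k => |latticeDrift a b δ n k|) := (hD.mono one_le_two).abs
  set c := kinkMean a b h with hc
  set g := steinSol a b h with hg
  set u : ℕ → ℝ := fun k => δ * ((k : ℝ) - n) with hu
  obtain ⟨C, hC⟩ : ∃ C, ∀ x, |g x| ≤ C := by
    refine ⟨1 / min 1 a, fun x => ?_⟩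
    have h0 : 0 < min 1 a := lt_min one_pos H.a_pos
    rw [le_div_iff₀ h0, mul_comm]
    exact abs_steinSol_le H.a_pos hh h0 (min_le_right _ _) (min_le_left _ _) x
  have bγ : ∀ {m}, PolyBdd m fun k => g (u k - δ) := fun {m} =>
    (PolyBdd.const C).of_abs_le fun k => (hC _).trans (le_abs_self C)
  have bg : PolyBdd 2 fun k => g (u k) :=
    (PolyBdd.const C).of_abs_le fun k => (hC _).trans (le_abs_self C)
  have bh : PolyBdd 1 fun k => h (u k) := by
    have : PolyBdd 1 fun k => |h 0| + |u k| := (PolyBdd.const _).add (PolyBdd.lattice δ n).abs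
    refine this.of_abs_le fun k => le_trans ?_ (le_abs_self _)
    have h1 := hh (u k) 0
    have h2 := abs_add_le (h (u k) - h 0) (h 0)
    rw [sub_add_cancel] at h2
    rw [sub_zero] at h1
    linarith
  have bH : PolyBdd 1 fun k => c - h (u k) := (PolyBdd.const c).sub bh
  have step : ∀ k, u (k + 1) - δ = u k := fun k => by simp only [hu]; push_cast; ring
  have e1 : mean p (fun k => (1 - δ * latticeDrift a b δ n k) * g (u k - δ) - g (u k)) = 0 := by
    have h1 := H.mean_drift_mul (g := fun k => g (u k - δ)) bγ
    simp only [step] at h1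
    have h2 : mean p (fun k => (g (u k) - g (u k - δ)) / δ) =
        1 / δ * (mean p (fun k => g (u k)) - mean p (fun k => g (u k - δ))) := by
      rw [← H.mean_sub bg bγ, ← mean_const_mul]
      congr 1; ext k; ring
    rw [h2] at h1
    have h3 : (fun k => (1 - δ * latticeDrift a b δ n k) * g (u k - δ) - g (u k)) =
        fun k => (g (u k - δ) - g (u k)) - δ * (latticeDrift a b δ n k * g (u k - δ)) := by
      ext k; ring
    rw [h3, H.mean_sub (PolyBdd.sub bγ bg) ((hD.mul (bγ (m := 1))).const_mul δ), H.mean_sub bγ bg,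
      mean_const_mul, h1]
    field_simp
    ring
  have bDH : PolyBdd 2 fun k => latticeDrift a b δ n k * (c - h (u k)) := hD.mul bH
  have bHH : PolyBdd 2 fun k => c - h (u k) := bH.mono one_le_two
  have bE1 : PolyBdd 2 fun k => (1 - δ * latticeDrift a b δ n k) * g (u k - δ) - g (u k) :=
    (PolyBdd.mul (m := 1) (l := 1) ((PolyBdd.const 1).sub (hD.const_mul δ)) bγ).sub bg
  have bE2 : PolyBdd 2 fun k => δ * ((1 - δ / 2 * latticeDrift a b δ n k) * (c - h (u k))) :=
    (PolyBdd.mul (m := 1) (l := 1) ((PolyBdd.const 1).sub (hD.const_mul _)) bH).const_mul δ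
  have bB : PolyBdd 2 fun k => δ ^ 2 * (T k + 1 + |latticeDrift a b δ n k|) :=
    ((bT.add (PolyBdd.const 1)).add bA).const_mul _
  have e2 : mean p (fun k => δ * ((1 - δ / 2 * latticeDrift a b δ n k) * (c - h (u k)))) =
      δ * (mean p (fun k => c - h (u k)) -
        δ / 2 * mean p (fun k => latticeDrift a b δ n k * (c - h (u k)))) := by
    rw [mean_const_mul, ← mean_const_mul p _ (δ / 2), ← H.mean_sub bHH (bDH.const_mul _)]
    congr 2; ext k; ring
  -- Summation by parts leaves difference quotients of h, bounded by 1; hence the correction δ/2 · D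
  -- in the cell estimate costs only δ/2.
  have e3 : |mean p (fun k => latticeDrift a b δ n k * (c - h (u k)))| ≤ 1 := by
    rw [H.mean_drift_mul bH, abs_neg, ← H.mean_const 1]
    have b0 : PolyBdd 2 fun k => (c - h (u (k + 1)) - (c - h (u k))) / δ := by
      simpa [div_eq_inv_mul] using (bHH.shift.sub bHH).const_mul δ⁻¹
    have hk : ∀ k, |(c - h (u (k + 1)) - (c - h (u k))) / δ| ≤ 1 := fun k => by
      rw [abs_div, abs_of_pos hδ, div_le_one hδ, sub_sub_sub_cancel_left]
      refine (hh _ _).trans ?_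
      rw [← step k, sub_sub_cancel_left, abs_neg, abs_of_pos hδ]
    have h2 := H.mean_mono b0 (PolyBdd.const 1) fun k => (abs_le.1 (hk k)).2
    have h3 := H.mean_mono b0.neg (PolyBdd.const 1) fun k => by linarith [(abs_le.1 (hk k)).1]
    rw [mean_neg] at h3
    rw [abs_le]
    constructor <;> linarith
  have e4 : |mean p (fun k => δ * ((1 - δ / 2 * latticeDrift a b δ n k) * (c - h (u k))))| ≤
      δ ^ 2 * (mean p T + 1 + mean p (fun k => |latticeDrift a b δ n k|)) := by
    have h0 : mean p (fun k => δ ^ 2 * (T k + 1 + |latticeDrift a b δ n k|)) =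
        δ ^ 2 * (mean p T + 1 + mean p (fun k => |latticeDrift a b δ n k|)) := by
      rw [mean_const_mul, H.mean_add (bT.add (PolyBdd.const 1)) bA, H.mean_add bT (PolyBdd.const 1),
        H.mean_const]
    have h1 := H.mean_add bE1 bE2
    rw [e1, zero_add] at h1
    rw [← h1, ← h0, abs_le, ← mean_neg]
    exact ⟨H.mean_mono bB.neg (bE1.add bE2) fun k => (abs_le.1 (H.cell_estimate hh hT k)).1,
      H.mean_mono (bE1.add bE2) bB fun k => (abs_le.1 (H.cell_estimate hh hT k)).2⟩
  rw [e2, abs_mul, abs_of_pos hδ, pow_two, mul_assoc] at e4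
  have e5 := le_of_mul_le_mul_left e4 hδ
  have e6 : mean p (fun k => c - h (u k)) = c - mean p (fun k => h (u k)) := by
    rw [H.mean_sub (PolyBdd.const c) (bh.mono one_le_two), H.mean_const]
  rw [abs_sub_comm, ← e6]
  have e7 := H.mean_abs_drift_le
  have e8 : |δ / 2 * mean p (fun k => latticeDrift a b δ n k * (c - h (u k)))| ≤ δ / 2 := by
    rw [abs_mul, abs_of_pos (by positivity : 0 < δ / 2)]
    have := mul_le_mul_of_nonneg_left e3 (by positivity : 0 ≤ δ / 2)
    linarith
  have e9 := abs_add_le (mean p (fun k => c - h (u k)) -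
    δ / 2 * mean p (fun k => latticeDrift a b δ n k * (c - h (u k))))
    (δ / 2 * mean p (fun k => latticeDrift a b δ n k * (c - h (u k))))
  rw [sub_add_cancel] at e9
  nlinarith

/-- Stein bound between the chain and the diffusion, uniform over the kink parameters. -/
theorem abs_mean_sub_kinkMean_le (H : IsKinkChain a b δ n p) {h : ℝ → ℝ}
    (hh : ∀ x y, |h x - h y| ≤ |x - y|) :
    |mean p (fun k => h (δ * ((k : ℝ) - n))) - kinkMean a b h| ≤ 1000 * (1 + a) ^ 2 * δ := by
  have hδ := H.delta_pos
  have ha := H.a_pos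
  -- For a ≤ 1 the constant is 971 + 2 + 1/2, where 971 = 2 · 483 + 5; for a ≥ 1 it is a quadratic
  -- polynomial in a.
  rcases le_total a 1 with ha1 | ha1
  · obtain ⟨T, bT, hTm, hT⟩ := H.exists_cellBound_of_le_one ha1
    refine (H.abs_mean_sub_kinkMean_le_of_cellBound hh bT (hT h hh)).trans ?_
    rw [mul_comm]
    refine mul_le_mul_of_nonneg_right ?_ hδ.le
    rw [max_eq_left ha1]
    nlinarith
  · obtain ⟨T, bT, hTm, hT⟩ := H.exists_cellBound_of_one_le ha1
    refine (H.abs_mean_sub_kinkMean_le_of_cellBound hh bT (hT h hh)).trans ?_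
    rw [mul_comm]
    refine mul_le_mul_of_nonneg_right ?_ hδ.le
    rw [max_eq_right ha1]
    nlinarith

end IsKinkChain

/-! ### From sums and weights back to measures -/

theorem integrable_nat_of_summable {p : Measure ℕ} [IsProbabilityMeasure p] {f : ℕ → ℝ}
    (hf : Summable fun k => p.real {k} * |f k|) :
    Integrable f p := by
  refine ⟨(measurable_of_countable f).aestronglyMeasurable, ?_⟩
  rw [HasFiniteIntegral, lintegral_countable']
  have e : ∀ k, ‖f k‖ₑ * p {k} = ENNReal.ofReal (p.real {k} * |f k|) := fun k => by
    rw [ENNReal.ofReal_mul measureReal_nonneg, ofReal_measureReal, mul_comm,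
      ← Real.norm_eq_abs, ofReal_norm]
  simp_rw [e]
  rw [← ENNReal.ofReal_tsum_of_nonneg (fun k => by positivity) hf]
  exact ENNReal.ofReal_lt_top

theorem integral_nat_eq_mean {p : Measure ℕ} {f : ℕ → ℝ} (hf : Integrable f p) :
    ∫ k, f k ∂p = mean (fun k => p.real {k}) f := by
  rw [integral_countable hf, mean]
  rfl

/-- Law with density proportional to `kinkWeight a b`, translated by `-z`. -/
def kinkLaw (a b z : ℝ) : Measure ℝ :=
  volume.withDensity fun x =>
    ENNReal.ofReal ((∫ y, kinkWeight a b y)⁻¹ * kinkWeight a b (x + z))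

section ContinuousLaw

variable {a b z : ℝ}

theorem kinkDensity_nonneg (ha : 0 < a) (x : ℝ) :
    0 ≤ (∫ y, kinkWeight a b y)⁻¹ * kinkWeight a b (x + z) :=
  mul_nonneg (inv_nonneg.2 (integral_kinkWeight_pos ha b).le) (kinkWeight_pos a b _).le

theorem measurable_kinkDensity :
    Measurable fun x => ENNReal.ofReal ((∫ y, kinkWeight a b y)⁻¹ * kinkWeight a b (x + z)) :=
  (((continuous_kinkWeight a b).comp (continuous_add_const z)).const_mul _).measurable.ennreal_ofReal

theorem isProbabilityMeasure_kinkLaw (ha : 0 < a) : IsProbabilityMeasure (kinkLaw a b z) := by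
  constructor
  rw [kinkLaw, withDensity_apply _ MeasurableSet.univ, setLIntegral_univ,
    ← ofReal_integral_eq_lintegral_ofReal
      (((integrable_kinkWeight ha b).comp_add_right z).const_mul _)
      (Filter.Eventually.of_forall fun x => kinkDensity_nonneg ha x),
    integral_const_mul, integral_add_right_eq_self (kinkWeight a b),
    inv_mul_cancel₀ (integral_kinkWeight_pos ha b).ne', ENNReal.ofReal_one]

theorem integrable_kinkLaw (ha : 0 < a) {f : ℝ → ℝ} (hf : LinGrowth fun u => f (u - z)) :
    Integrable f (kinkLaw a b z) := by
  rw [kinkLaw, integrable_withDensity_iff_integrable_smul' measurable_kinkDensity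
    (Filter.Eventually.of_forall fun x => ENNReal.ofReal_lt_top)]
  have h1 := ((integrable_mul_kinkWeight ha b hf).comp_add_right z).const_mul
    (∫ y, kinkWeight a b y)⁻¹
  refine h1.congr (Filter.Eventually.of_forall fun x => ?_)
  dsimp only
  rw [ENNReal.toReal_ofReal (kinkDensity_nonneg ha x), smul_eq_mul, add_sub_cancel_right]
  ring

theorem integral_kinkLaw (ha : 0 < a) (f : ℝ → ℝ) :
    ∫ x, f x ∂kinkLaw a b z = kinkMean a b fun u => f (u - z) := by
  rw [kinkLaw, integral_withDensity_eq_integral_toReal_smul measurable_kinkDensity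
    (Filter.Eventually.of_forall fun x => ENNReal.ofReal_lt_top)]
  have h1 : ∀ x, (ENNReal.ofReal ((∫ y, kinkWeight a b y)⁻¹ * kinkWeight a b (x + z))).toReal • f x =
      (∫ y, kinkWeight a b y)⁻¹ * (fun u => f (u - z) * kinkWeight a b u) (x + z) := fun x => by
    dsimp only
    rw [ENNReal.toReal_ofReal (kinkDensity_nonneg ha x), smul_eq_mul, add_sub_cancel_right]
    ring
  simp_rw [h1]
  rw [integral_const_mul, integral_add_right_eq_self (fun u => f (u - z) * kinkWeight a b u),
    kinkMean, div_eq_inv_mul]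

end ContinuousLaw

/-! ### Erlang-A in kink coordinates -/

section ErlangA

/-- The drift of the diffusion at the kink, divided by `mu`. -/
def kinkLevel (n : ℕ) (lam mu alpha : ℝ) : ℝ :=
  alpha / mu * max (zetaParam n lam mu alpha) 0 - max (-zetaParam n lam mu alpha) 0

variable {n : ℕ} {lam mu alpha : ℝ}

theorem diffusionDrift_eq (hmu : 0 < mu) (y : ℝ) :
    diffusionDrift n lam mu alpha y = mu *
      kinkDrift (alpha / mu) (kinkLevel n lam mu alpha) (y + zetaParam n lam mu alpha) := by
  unfold diffusionDrift kinkDrift kinkLevel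
  field_simp
  ring

theorem diffusionWeight_eq (hmu : 0 < mu) (x : ℝ) :
    diffusionWeight n lam mu alpha x =
      (kinkWeight (alpha / mu) (kinkLevel n lam mu alpha) (zetaParam n lam mu alpha))⁻¹ *
      kinkWeight (alpha / mu) (kinkLevel n lam mu alpha) (x + zetaParam n lam mu alpha) := by
  set a := alpha / mu
  set b := kinkLevel n lam mu alpha
  set z := zetaParam n lam mu alpha
  have hder : ∀ y, HasDerivAt (fun y => Real.log (kinkWeight a b (y + z))) (kinkDrift a b (y + z)) y := by
    intro y
    have h1 := (hasDerivAt_kinkWeight a b (y + z)).comp_add_const y z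
    have h2 := kinkWeight_pos a b (y + z)
    refine (h1.log h2.ne').congr_deriv ?_
    field_simp
  have hint : ∫ y in (0 : ℝ)..x, kinkDrift a b (y + z) =
      Real.log (kinkWeight a b (x + z)) - Real.log (kinkWeight a b (0 + z)) :=
    intervalIntegral.integral_eq_sub_of_hasDerivAt (fun y _ => hder y)
      (((LinGrowth.kinkDrift a b).1.comp (continuous_add_const z)).intervalIntegrable _ _)
  unfold diffusionWeight
  simp_rw [diffusionDrift_eq hmu]
  rw [intervalIntegral.integral_const_mul, hint, ← mul_assoc, one_div, inv_mul_cancel₀ hmu.ne',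
    one_mul, zero_add, Real.exp_sub, Real.exp_log (kinkWeight_pos _ _ _),
    Real.exp_log (kinkWeight_pos _ _ _), div_eq_inv_mul]

theorem diffusionLaw_eq (hmu : 0 < mu) : diffusionLaw n lam mu alpha =
    kinkLaw (alpha / mu) (kinkLevel n lam mu alpha) (zetaParam n lam mu alpha) := by
  unfold diffusionLaw kinkLaw
  simp_rw [diffusionWeight_eq hmu]
  congr 1
  ext x
  rw [integral_const_mul, integral_add_right_eq_self (kinkWeight _ _), mul_inv, inv_inv]
  have := (kinkWeight_pos (alpha / mu) (kinkLevel n lam mu alpha) (zetaParam n lam mu alpha)).ne'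
  congr 1
  field_simp

/-- The fluid equilibrium drops out: with load above or below n, b is the net rate at n customers
divided by `mu` √R. This lets both regimes be treated at once. -/
theorem kinkLevel_mul (hmu : 0 < mu) (ha : 0 < alpha) (hR : 0 < offeredLoad lam mu) :
    mu * Real.sqrt (offeredLoad lam mu) * kinkLevel n lam mu alpha = lam - n * mu := by
  have hs : 0 < Real.sqrt (offeredLoad lam mu) := Real.sqrt_pos.2 hR
  unfold kinkLevel zetaParam fluidEquilibrium
  split_ifs with h
  · have h1 : 0 ≤ (lam - n * mu) / alpha := by
      refine div_nonneg ?_ ha.le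
      rw [offeredLoad, le_div_iff₀ hmu] at h
      linarith
    have h2 : 0 ≤ (n + (lam - n * mu) / alpha - n) / Real.sqrt (offeredLoad lam mu) :=
      div_nonneg (by linarith) hs.le
    rw [max_eq_left h2, max_eq_right (by linarith)]
    field_simp
    ring
  · push Not at h
    have h2 : (offeredLoad lam mu - n) / Real.sqrt (offeredLoad lam mu) ≤ 0 :=
      div_nonpos_of_nonpos_of_nonneg (by linarith) hs.le
    rw [max_eq_right h2, max_eq_left (by linarith)]
    have h3 : lam = offeredLoad lam mu * mu := by unfold offeredLoad; field_simp
    calc _ = mu * (offeredLoad lam mu - n) := by field_simp; ring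
      _ = _ := by nlinarith

theorem sub_departureRate_eq (hmu : 0 < mu) (ha : 0 < alpha) (hR : 0 < offeredLoad lam mu) (k : ℕ) :
    lam - departureRate n mu alpha k = mu * Real.sqrt (offeredLoad lam mu) *
      latticeDrift (alpha / mu) (kinkLevel n lam mu alpha) (1 / Real.sqrt (offeredLoad lam mu)) n k := by
  have hs : 0 < Real.sqrt (offeredLoad lam mu) := Real.sqrt_pos.2 hR
  have h1 := kinkLevel_mul (n := n) hmu ha hR
  set s := Real.sqrt (offeredLoad lam mu)
  have hs' : 0 < 1 / s := by positivity
  unfold departureRate latticeDrift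
  rcases le_total (k : ℝ) n with h | h
  · rw [kinkDrift_of_nonpos (mul_nonpos_of_nonneg_of_nonpos hs'.le (by linarith)), min_eq_left h,
      max_eq_right (by linarith), mul_sub, h1]
    field_simp
    ring
  · rw [kinkDrift_of_nonneg (mul_nonneg hs'.le (by linarith)), min_eq_right h,
      max_eq_left (by linarith), mul_sub, h1]
    field_simp
    ring

theorem IsErlangAStationary.isKinkChain (hlam : 0 < lam) (hmu : 0 < mu) (ha : 0 < alpha)
    (hR : 1 ≤ offeredLoad lam mu) {p : Measure ℕ} (hp : IsErlangAStationary n lam mu alpha p) :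
    IsKinkChain (alpha / mu) (kinkLevel n lam mu alpha) (1 / Real.sqrt (offeredLoad lam mu)) n
      (fun k => p.real {k}) := by
  have hR0 : 0 < offeredLoad lam mu := by linarith
  have hs : 0 < Real.sqrt (offeredLoad lam mu) := Real.sqrt_pos.2 hR0
  have hprob := hp.1
  have hs2 : mu * Real.sqrt (offeredLoad lam mu) ^ 2 = lam := by
    rw [Real.sq_sqrt hR0.le]; unfold offeredLoad; field_simp
  have key : ∀ k : ℕ, 1 / Real.sqrt (offeredLoad lam mu) * latticeDrift (alpha / mu)
      (kinkLevel n lam mu alpha) (1 / Real.sqrt (offeredLoad lam mu)) n k =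
      (lam - departureRate n mu alpha k) / lam := by
    intro k
    rw [sub_departureRate_eq hmu ha hR0, eq_div_iff hlam.ne', mul_right_comm]
    congr 1
    rw [one_div_mul_eq_div, div_eq_iff hs.ne', mul_assoc, ← pow_two, hs2]
  refine ⟨by positivity, by positivity, ?_, fun k => measureReal_nonneg, hasSum_real_singleton p,
    fun k => ?_, ?_⟩
  · rw [div_le_one hs]
    exact Real.one_le_sqrt.2 hR
  · have h1 := hp.detailed_balance hlam hmu ha k
    rw [key]
    field_simp
    linarith
  · rw [key, departureRate_zero]
    field_simp
    ring

theorem integrable_comp_lattice {a b δ : ℝ} {p : Measure ℕ} [IsProbabilityMeasure p]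
    (H : IsKinkChain a b δ n (fun k => p.real {k})) {h : ℝ → ℝ}
    (hh : ∀ x y, |h x - h y| ≤ |x - y|) :
    Integrable (fun k : ℕ => h (δ * ((k : ℝ) - n))) p := by
  refine integrable_nat_of_summable ?_
  refine H.summable (m := 1) (PolyBdd.abs (PolyBdd.of_abs_le (g := fun k => |h 0| + |δ * ((k : ℝ) - n)|)
    ((PolyBdd.const _).add (PolyBdd.lattice δ n).abs) fun k => le_trans ?_ (le_abs_self _)))
  have h1 := hh (δ * ((k : ℝ) - n)) 0
  have h2 := abs_add_le (h (δ * ((k : ℝ) - n)) - h 0) (h 0)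
  rw [sub_add_cancel] at h2
  rw [sub_zero] at h1
  linarith

theorem scaledLaw_eq (p : Measure ℕ) : scaledLaw n lam mu alpha p =
    p.map fun k : ℕ => 1 / Real.sqrt (offeredLoad lam mu) * ((k : ℝ) - n) -
      zetaParam n lam mu alpha := by
  unfold scaledLaw zetaParam
  congr 1
  ext k
  ring

end ErlangA

theorem theorem2 :
    ∃ C : ℝ → ℝ, (∀ x, 0 ≤ x → 0 ≤ C x) ∧ StrictMonoOn C (Set.Ici 0) ∧
      ∀ (n : ℕ) (lam mu alpha : ℝ), 1 ≤ n → 0 < lam → 0 < mu → 0 < alpha →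
        1 ≤ offeredLoad lam mu →
        ∀ p : Measure ℕ, IsErlangAStationary n lam mu alpha p →
          IsProbabilityMeasure (diffusionLaw n lam mu alpha) ∧
          Integrable (fun x : ℝ => x) (scaledLaw n lam mu alpha p) ∧
          Integrable (fun x : ℝ => x) (diffusionLaw n lam mu alpha) ∧
          wassersteinDist (scaledLaw n lam mu alpha p) (diffusionLaw n lam mu alpha) ≤
            ENNReal.ofReal (C (alpha / mu) / Real.sqrt (offeredLoad lam mu)) := by
  refine ⟨fun x => 1000 * (1 + x) ^ 2, fun x _ => by positivity, ?_, ?_⟩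
  · intro x hx y hy hxy
    have hx' : (0 : ℝ) ≤ x := hx
    dsimp only
    gcongr
  intro n lam mu alpha _ hlam hmu ha hR p hp
  have hprob := hp.1
  have H := hp.isKinkChain hlam hmu ha hR
  have ha' : 0 < alpha / mu := H.a_pos
  set z := zetaParam n lam mu alpha
  have hmeas : Measurable fun k : ℕ => 1 / Real.sqrt (offeredLoad lam mu) * ((k : ℝ) - n) - z :=
    measurable_of_countable _
  -- Both laws are their kink-coordinate versions translated by -ζ, so the Stein bound is applied to
  -- h(· - ζ).
  have shift : ∀ {h : ℝ → ℝ}, (∀ x y, |h x - h y| ≤ |x - y|) →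
      ∀ x y, |h (x - z) - h (y - z)| ≤ |x - y| := fun hh x y => by
    have := hh (x - z) (y - z)
    rwa [sub_sub_sub_cancel_right] at this
  have hid : ∀ x y : ℝ, |(fun x => x) x - (fun x => x) y| ≤ |x - y| := fun x y => le_rfl
  rw [diffusionLaw_eq hmu, scaledLaw_eq]
  refine ⟨isProbabilityMeasure_kinkLaw ha', ?_,
    integrable_kinkLaw ha' (LinGrowth.of_lipschitz (shift hid)), ?_⟩
  · exact (integrable_map_measure measurable_id.aestronglyMeasurable hmeas.aemeasurable).2
      (integrable_comp_lattice H (shift hid))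
  · refine iSup_le fun ⟨h, hL⟩ => ENNReal.ofReal_le_ofReal ?_
    have hh : ∀ x y, |h x - h y| ≤ |x - y| := fun x y => by
      simpa [Real.dist_eq] using hL.dist_le_mul x y
    dsimp only
    rw [integral_map hmeas.aemeasurable hL.continuous.aestronglyMeasurable, integral_kinkLaw ha',
      integral_nat_eq_mean (integrable_comp_lattice H (shift hh))]
    exact (H.abs_mean_sub_kinkMean_le (shift hh)).trans_eq (mul_one_div _ _)

end
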